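/- Let $Gr_8(\mathbb R^{10})$ be the Grassmannian of oriented 8-planes in $\mathbb R^{10}$. For an oriented 8-plane $W$ let $W^\perp$ be the orthogonal 2-plane, oriented so that $W\oplus W^\perp=\mathbb R^{10}$ as oriented spaces. Let $Q_8=\{[z]\in\mathbb{CP}^9: z_0^2+\dots+z_9^2=0\}$. (0) The map $W\mapsto[p+iq]$, where $(p,q)$ is any positive orthonormal basis of $W^\perp$, is a well-defined diffeomorphism $Gr_8(\mathbb R^{10})\cong Q_8$. (1) For an orthogonal complex structure $J$ on $\mathbb R^{10}$ (an orthogonal $J$ with $J^2=-1$), let $C_J\subset Gr_8(\mathbb R^{10})$ be the set of all $W$ such that $W^\perp$ is $J$-invariant and oriented by $J$, i.e. has a positive orthonormal basis of the form $(p,Jp)$. Under (0), $C_J$ corresponds to a complex projective 4-space $\mathbb P(E)\subset Q_8\subset\mathbb{CP}^9$, $\dim_{\mathbb C}E=5$. Let $\mathcal F$ (resp. $\mathcal F'$) be the family of all $C_J$ where $J$ induces the standard (resp. the opposite) orientation of $\mathbb R^{10}$. These families are disjoint. Let $J_0$ be the standard complex structure of $\mathbb R^{10}=\mathbb C^5$.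 The map $g\,\mathrm U(5)\mapsto gJ_0g^{-1}$ is a homeomorphism of $\mathrm{SO}(10)/\mathrm U(5)$ onto the space of orthogonal complex structures that induce the standard orientation, the $-gJ_0g^{-1}$ are exactly those that induce the opposite one, and $g\,\mathrm U(5)\mapsto C_{gJ_0g^{-1}}$ and $g\,\mathrm U(5)\mapsto C_{-gJ_0g^{-1}}$ are homeomorphisms of $\mathrm{SO}(10)/\mathrm U(5)$ onto $\mathcal F$ and $\mathcal F'$ (with the Vietoris topology on subsets of $Gr_8(\mathbb R^{10})$). (2) For a unit vector $u\in S^9\subset\mathbb R^{10}$ orient the hyperplane $u^\perp$ so that a positive basis of $u^\perp$ followed by $u$ is positive, and orient its unit sphere $S(u^\perp)\cong S^8$, the set of oriented lines in $u^\perp$, accordingly. Let $h_u:S(u^\perp)\to Gr_8(\mathbb R^{10})$ send $x$ to its oriented orthogonal complement $W$ in the oriented hyperplane $u^\perp$ (so $W^\perp$ is oriented by $(x,u)$), and let $h'_u:S(u^\perp)\to Gr_8(\mathbb R^{10})$ send $x$ to the $W$ whose $W^\perp$ is the oriented 2-plane $u\wedge x$ through the oriented line $u$ (oriented by $(u,x)$).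 Both are smooth embeddings, so they define oriented 8-spheres $H_u$ and $H'_u$ in $Gr_8(\mathbb R^{10})$ (an oriented 8-sphere is here a smooth embedding of the round $S^8$, up to rotations of $S^8$). The point set of $H_u$ is the set of all $W\subset u^\perp$, and that of $H'_u$ is the set of all $W$ with $u\in W^\perp$ (as point sets these are equal; the two spheres have opposite orientations). The families $\mathcal H=\{H_u\}$ and $\mathcal H'=\{H'_u\}$ of oriented 8-spheres are disjoint. Each of them is parametrized by $u\in S^9$ as follows: sending $u$ to the graph of $h_u$ (resp. of $h'_u$) is a homeomorphism of $S^9$ onto its image in the subsets of $\mathbb R^{10}\times Gr_8(\mathbb R^{10})$ with the Vietoris topology; the point sets depend continuously on $u$; and if the identification with $S(u^\perp)$ is forgotten, then exactly $u$ and $-u$ give the same sphere, both as an oriented sphere and as a point set. (3) Every point of $Gr_8(\mathbb R^{10})$ lies on infinitely many members of each of the families $\mathcal F$, $\mathcal F'$, $\mathcal H$, $\mathcal H'$. -/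

import Mathlib

open scoped LinearAlgebra.Projectivization ContDiff

/-! ### Smooth maps between subsets of Euclidean spaces -/

/-- Let `i : X → E` and `j : X → F` be maps into real normed spaces. `SmoothThrough i j` says that
`i x ↦ j x` is a well defined smooth map from the subset `i (X)` of `E` to `F`, i.e. that it extends
to a smooth map on a neighbourhood of each point of `i (X)`. -/
def SmoothThrough {X E F : Type*} [NormedAddCommGroup E] [NormedSpace ℝ E]
    [NormedAddCommGroup F] [NormedSpace ℝ F] (i : X → E) (j : X → F) : Prop :=
  ∀ x : X, ∃ U : Set E, IsOpen U ∧ i x ∈ U ∧ ∃ g : E → F, ContDiffOn ℝ ∞ g U ∧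
    ∀ x' : X, i x' ∈ U → g (i x') = j x'

/-- The map `f` between sets `X ⊆ E` and `Y ⊆ F` (embedded by injections `i` and `j`) is a
diffeomorphism of `X` onto its image: it is smooth, injective, and its inverse is smooth on the
image. -/
def IsSmoothEmbeddingVia {X Y E F : Type*} [NormedAddCommGroup E] [NormedSpace ℝ E]
    [NormedAddCommGroup F] [NormedSpace ℝ F] (i : X → E) (j : Y → F) (f : X → Y) : Prop :=
  Function.Injective f ∧ SmoothThrough i (j ∘ f) ∧ SmoothThrough (j ∘ f) i

/-- A map into the set of subsets of a space is continuous for the Vietoris topology. -/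
def VietorisContinuous {X Y : Type*} [TopologicalSpace X] [TopologicalSpace Y]
    (f : X → Set Y) : Prop :=
  @Continuous X (Set Y) _ (TopologicalSpace.vietoris Y) f

/-- A map into the set of subsets of a space is a homeomorphism onto its image, for the Vietoris
topology. -/
def VietorisEmbedding {X Y : Type*} [TopologicalSpace X] [TopologicalSpace Y]
    (f : X → Set Y) : Prop :=
  @Topology.IsEmbedding X (Set Y) _ (TopologicalSpace.vietoris Y) f

/-! ### Oriented Grassmannians of `ℝ¹⁰` -/

abbrev R10 := EuclideanSpace ℝ (Fin 10)
abbrev C10 := EuclideanSpace ℂ (Fin 10)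
abbrev R9 := EuclideanSpace ℝ (Fin 9)

/-- The unit sphere `S⁹` of `ℝ¹⁰`. -/
abbrev S9 := Metric.sphere (0 : R10) 1

/-- The unit sphere `S⁸` of `ℝ⁹`. -/
abbrev S8 := Metric.sphere (0 : R9) 1

/-- The Stiefel manifold of orthonormal `k`-frames in `ℝ¹⁰`. -/
abbrev Frame (k : ℕ) := {A : Fin k → R10 // Orthonormal ℝ A}

/-- Two orthonormal frames are bases, of the same orientation, of the same subspace iff they differ
by an element of `SO(k)`. -/
def frameSetoid (k : ℕ) : Setoid (Frame k) where
  r A B := ∃ g ∈ Matrix.specialOrthogonalGroup (Fin k) ℝ, ∀ i, B.1 i = ∑ j, g i j • A.1 j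
  iseqv := by
    refine ⟨fun A => ⟨1, one_mem _, fun i => ?_⟩, ?_, ?_⟩
    · simp [Matrix.one_apply]
    · rintro A B ⟨g, hg, h⟩
      refine ⟨star g, ?_, fun i => ?_⟩
      · exact (star (⟨g, hg⟩ : Matrix.specialOrthogonalGroup (Fin k) ℝ)).2
      · have hgg : star g * g = 1 := (Matrix.mem_specialOrthogonalGroup_iff.1 hg).1.1
        simp_rw [h, Finset.smul_sum, smul_smul]
        rw [Finset.sum_comm]
        simp_rw [← Finset.sum_smul, ← Matrix.mul_apply, hgg]
        simp [Matrix.one_apply]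
    · rintro A B C ⟨g, hg, h⟩ ⟨g', hg', h'⟩
      refine ⟨g' * g, mul_mem hg' hg, fun i => ?_⟩
      simp_rw [h', h, Finset.smul_sum, smul_smul]
      rw [Finset.sum_comm]
      simp_rw [← Finset.sum_smul, ← Matrix.mul_apply]

/-- The Grassmannian of oriented `k`-planes in `ℝ¹⁰`, with the quotient topology. -/
def Gr (k : ℕ) := Quotient (frameSetoid k)

instance (k : ℕ) : TopologicalSpace (Gr k) :=
  inferInstanceAs (TopologicalSpace (Quotient (frameSetoid k)))

/-- The oriented `k`-plane with a given positive orthonormal basis. -/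
def Gr.mk {k : ℕ} (A : Frame k) : Gr k := Quotient.mk (frameSetoid k) A

/-- The Plücker embedding of the oriented Grassmannian: the list of all `k × k` minors of the matrix
of a positive orthonormal basis. It defines the smooth structure of the Grassmannian. -/
noncomputable def Gr.plucker {k : ℕ} : Gr k → ((Fin k → Fin 10) → ℝ) :=
  Quotient.lift
    (fun (A : Frame k) (s : Fin k → Fin 10) => (Matrix.of fun i j => A.1 i (s j)).det) (by
      rintro A B ⟨g, hg, h⟩
      funext s
      have e : (Matrix.of fun i j => B.1 i (s j)) = g * Matrix.of fun i j => A.1 i (s j) := by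
        ext i j
        simp [h, Matrix.mul_apply]
      simp only [e, Matrix.det_mul, (Matrix.mem_specialOrthogonalGroup_iff.1 hg).2, one_mul])

/-- The vectors of `b` form a positive orthonormal basis of `ℝ¹⁰`. -/
def IsPosBasis (b : Fin 10 → R10) : Prop :=
  Orthonormal ℝ b ∧ 0 < (Matrix.of fun i j => b i j).det

/-- `(p, q)` is a positive orthonormal basis of the oriented orthogonal complement of the oriented
8-plane `W`, where `W ⊕ W^⊥ = ℝ¹⁰` as oriented spaces. -/
def PosCompl (W : Gr 8) (p q : R10) : Prop :=
  ∃ A : Frame 8, Gr.mk A = W ∧ IsPosBasis (Fin.append A.1 ![p, q])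

/-! ### The quadric `Q₈ ⊂ ℂP⁹` -/

/-- The embedding of `ℂP⁹` in a Euclidean space that sends a line to the orthogonal projection onto
it. It defines the smooth structure of `ℂP⁹`. -/
noncomputable def projOnto (z : ℙ ℂ C10) : C10 →L[ℂ] C10 :=
  haveI : FiniteDimensional ℂ z.submodule := inferInstance
  z.submodule.starProjection

/-- The quadric `z₀² + ⋯ + z₉² = 0`. -/
def Q8 : Set (ℙ ℂ C10) := {z | ∀ v ∈ z.submodule, ∑ k, v k ^ 2 = 0}

/-- The vector `p + i q`. -/
noncomputable def complexVec (p q : R10) : C10 :=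
  WithLp.toLp 2 fun k => (p k : ℂ) + Complex.I * (q k : ℂ)

/-- The set of points of `ℂP⁹` that lie in the projectivization of the linear subspace `E`. -/
def projSubspace (E : Submodule ℂ C10) : Set (ℙ ℂ C10) := {z | z.submodule ≤ E}

/-! ### Linear complex structures on `ℝ¹⁰` and the families of complex projective 4-spaces -/

abbrev Mat10 := Matrix (Fin 10) (Fin 10) ℝ
abbrev SO10 := Matrix.specialOrthogonalGroup (Fin 10) ℝ

/-- The image of a vector of `ℝ¹⁰` under a matrix. -/
noncomputable def matAct (J : Mat10) (p : R10) : R10 := WithLp.toLp 2 (J.mulVec p)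

/-- The matrix with rows `v₀, J v₀, …, v₄, J v₄`. -/
noncomputable def complexBasisMatrix (J : Mat10) (v : Fin 5 → R10) : Mat10 :=
  Matrix.of fun a b => ((![v 0, matAct J (v 0), v 1, matAct J (v 1), v 2, matAct J (v 2),
    v 3, matAct J (v 3), v 4, matAct J (v 4)] : Fin 10 → R10) a) b

/-- The orthogonal complex structures on `ℝ¹⁰` that induce the standard orientation. -/
def JPos : Set Mat10 :=
  {J | J ∈ Matrix.orthogonalGroup (Fin 10) ℝ ∧ J * J = -1 ∧
    ∃ v : Fin 5 → R10, 0 < (complexBasisMatrix J v).det}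

/-- The orthogonal complex structures on `ℝ¹⁰` that induce the opposite orientation. -/
def JNeg : Set Mat10 :=
  {J | J ∈ Matrix.orthogonalGroup (Fin 10) ℝ ∧ J * J = -1 ∧
    ∃ v : Fin 5 → R10, (complexBasisMatrix J v).det < 0}

/-- The real `10 × 10` matrix of a complex `5 × 5` matrix, for `ℂ⁵ = ℝ⁵ ⊕ i ℝ⁵`. -/
def realify (U : Matrix (Fin 5) (Fin 5) ℂ) : Mat10 :=
  Matrix.reindex (finSumFinEquiv (m := 5) (n := 5)) (finSumFinEquiv (m := 5) (n := 5))
    (Matrix.fromBlocks (U.map Complex.re) (-U.map Complex.im)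
      (U.map Complex.im) (U.map Complex.re))

theorem realify_one : realify 1 = 1 := by
  have h1 : (1 : Matrix (Fin 5) (Fin 5) ℂ).map Complex.re = 1 := by
    ext i j; by_cases h : i = j <;> simp [Matrix.one_apply, h]
  have h2 : (1 : Matrix (Fin 5) (Fin 5) ℂ).map Complex.im = 0 := by
    ext i j; by_cases h : i = j <;> simp [h]
  simp only [realify, h1, h2, neg_zero, Matrix.fromBlocks_one, Matrix.reindex_apply]
  exact Matrix.submatrix_one_equiv _

theorem realify_mul (U V : Matrix (Fin 5) (Fin 5) ℂ) :
    realify (U * V) = realify U * realify V := by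
  have h1 : (U * V).map Complex.re
      = U.map Complex.re * V.map Complex.re + -U.map Complex.im * V.map Complex.im := by
    ext i j; simp [Matrix.mul_apply, Finset.sum_add_distrib, sub_eq_add_neg]
  have h2 : (U * V).map Complex.im
      = U.map Complex.im * V.map Complex.re + U.map Complex.re * V.map Complex.im := by
    ext i j; simp [Matrix.mul_apply, Finset.sum_add_distrib, add_comm]
  simp only [realify, Matrix.reindex_apply]
  rw [Matrix.submatrix_mul_equiv, Matrix.fromBlocks_multiply, h1, h2]
  congr 2 <;> simp [add_comm]

/-- The standard complex structure `J₀` of `ℝ¹⁰ = ℂ⁵`. -/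
noncomputable def J0 : Mat10 := realify (Matrix.diagonal fun _ => Complex.I)

/-- The subgroup `U(5)` of `SO(10)`. -/
def U5 : Subgroup SO10 where
  carrier := {g | ∃ U ∈ Matrix.unitaryGroup (Fin 5) ℂ, realify U = g.1}
  one_mem' := ⟨1, one_mem _, realify_one⟩
  mul_mem' := by
    rintro a b ⟨U, hU, h⟩ ⟨V, hV, h'⟩
    exact ⟨U * V, mul_mem hU hV, by rw [realify_mul, h, h']; rfl⟩
  inv_mem' := by
    rintro a ⟨U, hU, h⟩
    refine ⟨star U, Unitary.star_mem hU, ?_⟩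
    have e1 : realify (star U) * a.1 = 1 := by
      rw [← h, ← realify_mul, hU.1, realify_one]
    have e2 : a.1 * (a⁻¹).1 = 1 := congrArg Subtype.val (mul_inv_cancel a)
    exact left_inv_eq_right_inv e1 e2

/-- The complex structure `g J₀ g⁻¹`. -/
noncomputable def conjJ0 (g : SO10) : Mat10 := g.1 * J0 * (g⁻¹).1

/-- The set of oriented 8-planes whose oriented complementary 2-plane is invariant under the complex
structure `J` and oriented by it, i.e. a complex line of `(ℝ¹⁰, J)`. -/
def complexLines (J : Mat10) : Set (Gr 8) := {W | ∃ p : R10, PosCompl W p (matAct J p)}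

/-- The two families of complex projective 4-spaces. -/
def familyF : Set (Set (Gr 8)) := complexLines '' JPos
def familyF' : Set (Set (Gr 8)) := complexLines '' JNeg

/-! ### The families of 8-spheres

A unit vector `u` stands for the oriented line that it spans and also for the oriented hyperplane
`u^⊥`, oriented so that a positive basis of it, followed by `u`, is a positive basis of `ℝ¹⁰`. -/

/-- An oriented 8-sphere in the Grassmannian: a smooth embedding of `S⁸`, up to composition with the
rotations of `S⁸`. -/
def IsOrientedSphere (S : Set (S8 → Gr 8)) : Prop :=
  ∃ f₀ : S8 → Gr 8, IsSmoothEmbeddingVia (fun y : S8 => (y : R9)) Gr.plucker f₀ ∧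
    S = {f | ∃ g : R9 ≃ₗᵢ[ℝ] R9, 0 < LinearMap.det (g.toLinearEquiv : R9 →ₗ[ℝ] R9) ∧
      ∀ y : S8, f y = f₀ ⟨g y, by simp⟩}

/-- The points of the Grassmannian covered by an oriented 8-sphere. -/
def sphereSupport (S : Set (S8 → Gr 8)) : Set (Gr 8) := {W | ∃ f ∈ S, ∃ y, f y = W}

/-- The oriented 8-planes contained in the hyperplane `u^⊥`. -/
def planesIn (u : R10) : Set (Gr 8) := {W | ∃ A : Frame 8, Gr.mk A = W ∧ ∀ i, inner ℝ (A.1 i) u = 0}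

/-- The oriented 8-planes whose complementary 2-plane contains the line spanned by `u`. -/
def planesThrough (u : R10) : Set (Gr 8) := {W | ∃ x : R10, PosCompl W u x}

/-- The pairs of an oriented line (with unit vector `x`) in the oriented hyperplane `u^⊥` and its
oriented orthogonal complement `W` in this hyperplane; so `(W, x, u)` is positive. -/
def markedH (u : R10) : Set (R10 × Gr 8) := {w | PosCompl w.2 w.1 u}

/-- The pairs of an oriented line (with unit vector `x`) in the oriented hyperplane `u^⊥` and the
8-plane whose oriented complement is the oriented 2-plane `u ∧ x` through the oriented line `u`. -/
def markedH' (u : R10) : Set (R10 × Gr 8) := {w | PosCompl w.2 u w.1}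

/-- `e` is a positive orthonormal basis of the oriented hyperplane `u^⊥`. -/
def IsHyperplaneBasis (u : R10) (e : Fin 9 → R10) : Prop :=
  IsPosBasis (Fin.snoc (α := fun _ => R10) e u)

/-- The oriented sphere of all oriented lines in the oriented hyperplane `u^⊥`, mapped to the
Grassmannian by `markedH u`. -/
def sphereH (u : R10) : Set (S8 → Gr 8) :=
  {f | ∃ e, IsHyperplaneBasis u e ∧ ∀ y : S8, (∑ i, y.1 i • e i, f y) ∈ markedH u}

/-- The oriented sphere of all oriented lines in the oriented hyperplane `u^⊥`, mapped to the
Grassmannian by `markedH' u`. -/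
def sphereH' (u : R10) : Set (S8 → Gr 8) :=
  {f | ∃ e, IsHyperplaneBasis u e ∧ ∀ y : S8, (∑ i, y.1 i • e i, f y) ∈ markedH' u}

/-- The two families of oriented 8-spheres. -/
def familyH : Set (Set (S8 → Gr 8)) := Set.range fun u : S9 => sphereH u
def familyH' : Set (Set (S8 → Gr 8)) := Set.range fun u : S9 => sphereH' u

/-! Everything passes through one invariant of an oriented 8-plane $W$: the bivector $p\wedge q$ of
its oriented complement, written as a skew matrix $F$ (`Gr.form`). Hodge duality
(`IsPosBasis.det_append_eq`, `IsPosBasis.minor_eq`) turns Plücker coordinates into $F$ and back by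
linear maps. As an operator $F$ is a quarter turn of $W^\perp$ ($q\mapsto p$, $p\mapsto -q$) and
vanishes on $W$, so it determines $W$ with its orientation (`Gr.form_injective`), and `PosCompl W p
q` becomes an equation between matrices (`posCompl_iff`). Compactness of the frame space makes $F$ a
closed embedding, which settles the topology of the Grassmannian.

Quadric: since $|p+iq|^2=2$, the projector onto $\mathbb C(p+iq)$ is $-\tfrac12(F^2+iF)$, and $F$ is
$-2$ times its imaginary part. These formulas are polynomial, hence smooth in both directions. Every
point of the quadric is reached because $\sum v_k^2=0$ says that real and imaginary parts are
orthogonal of equal length.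

Complex structures: the vectors $p+iJp$ form an isotropic complex subspace, a copy of $\mathbb
R^{10}$, hence of complex dimension 5. On a complex line $J$ equals $-F$, so $J$ can be read off
from its complex lines (`matAct_form_of_mem_complexLines`). Unitary frames conjugate any $J$ to
$J_0$ by an orthogonal $g$. A realified complex matrix has determinant $|\det|^2\ge 0$, so the
orientation of $J$ is the sign of $\det g$; $\mathrm U(5)$ is the stabilizer of $J_0$, and $-J$
reverses orientation because 5 is odd. Injective continuous maps from a compact space to compact
subsets with the Vietoris topology are embeddings (`VietorisContinuous.embedding`).

Spheres: $u\wedge x=x\wedge(-u)$, so both families consist of maps $x\mapsto (x\wedge w)^\perp$ with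
$w=\pm u$, inverted by $F w=x$. The symmetry $(x,u)\mapsto(-x,-u)$ identifies the spheres of $u$ and
$-u$, while $H_u=H'_u$ would make $-1$ orientation preserving in dimension 9. Continuity in $u$ is
checked on $\mathrm{SO}(10)$, which carries a continuous frame of $u^\perp$. Infinitely many members
through a point come from explicit one-parameter rotations. -/

/-! ### Orthonormal families and Gram matrices -/

/-- The matrix whose rows are the given vectors. -/
def rowMatrix {ι : Type*} (b : ι → R10) : Matrix ι (Fin 10) ℝ := Matrix.of fun i j => b i j

/-- The matrix of inner products of two families. -/
noncomputable def gramOf {ι κ : Type*} (b : ι → R10) (c : κ → R10) : Matrix ι κ ℝ :=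
  Matrix.of fun i j => inner ℝ (b i) (c j)

theorem inner_eq_sum {n : ℕ} (x y : EuclideanSpace ℝ (Fin n)) : inner ℝ x y = ∑ k, x k * y k := by
  simp [PiLp.inner_apply, mul_comm]

theorem rowMatrix_mul_transpose {ι κ : Type*} (b : ι → R10) (c : κ → R10) :
    rowMatrix b * (rowMatrix c).transpose = gramOf b c := by
  ext i j
  simp [rowMatrix, gramOf, Matrix.mul_apply, inner_eq_sum]

theorem orthonormal_iff_gramOf {ι : Type*} [DecidableEq ι] (b : ι → R10) :
    Orthonormal ℝ b ↔ gramOf b b = 1 := by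
  rw [orthonormal_iff_ite, ← Matrix.ext_iff]
  simp [gramOf, Matrix.one_apply]

/-- Reduces every comparison of orientations to inner products: two bases agree in orientation when
their mutual Gram determinant is positive. -/
theorem det_rowMatrix_mul_det_rowMatrix (b c : Fin 10 → R10) :
    (rowMatrix b).det * (rowMatrix c).det = (gramOf b c).det := by
  rw [← rowMatrix_mul_transpose, Matrix.det_mul, Matrix.det_transpose]

theorem IsPosBasis.det_eq_one {b : Fin 10 → R10} (h : IsPosBasis b) : (rowMatrix b).det = 1 := by
  have h1 := det_rowMatrix_mul_det_rowMatrix b b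
  rw [(orthonormal_iff_gramOf b).1 h.1, Matrix.det_one] at h1
  have h2 : 0 < (rowMatrix b).det := h.2
  nlinarith

/-- The family of the eight vectors `A` followed by the two vectors `v`. -/
def append82 (A : Fin 8 → R10) (v : Fin 2 → R10) : Fin 10 → R10 :=
  Fin.append (m := 8) (n := 2) A v

theorem append82_inl (A : Fin 8 → R10) (v : Fin 2 → R10) (i : Fin 8) :
    append82 A v (finSumFinEquiv (m := 8) (n := 2) (Sum.inl i)) = A i :=
  Fin.append_left (m := 8) (n := 2) A v i

theorem append82_inr (A : Fin 8 → R10) (v : Fin 2 → R10) (i : Fin 2) :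
    append82 A v (finSumFinEquiv (m := 8) (n := 2) (Sum.inr i)) = v i :=
  Fin.append_right (m := 8) (n := 2) A v i

theorem det_append82_mul (A B : Fin 8 → R10) (v w : Fin 2 → R10) :
    (rowMatrix (append82 A v)).det * (rowMatrix (append82 B w)).det =
      (Matrix.fromBlocks (gramOf A B) (gramOf A w) (gramOf v B) (gramOf v w)).det := by
  rw [det_rowMatrix_mul_det_rowMatrix,
    ← Matrix.det_submatrix_equiv_self (finSumFinEquiv (m := 8) (n := 2))]
  congr 1
  ext i j
  rcases i with i | i <;> rcases j with j | j <;>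
    simp only [gramOf, Matrix.submatrix_apply, Matrix.of_apply, append82_inl, append82_inr,
      Matrix.fromBlocks_apply₁₁, Matrix.fromBlocks_apply₁₂, Matrix.fromBlocks_apply₂₁,
      Matrix.fromBlocks_apply₂₂]

theorem orthonormal_append82_iff (A : Fin 8 → R10) (v : Fin 2 → R10) :
    Orthonormal ℝ (append82 A v) ↔
      Orthonormal ℝ A ∧ Orthonormal ℝ v ∧ ∀ i j, inner ℝ (A i) (v j) = 0 := by
  constructor
  · intro h
    have h' := h.comp _ (finSumFinEquiv (m := 8) (n := 2)).injective
    refine ⟨?_, ?_, fun i j => ?_⟩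
    · simpa only [Function.comp_def, append82_inl] using h'.comp Sum.inl Sum.inl_injective
    · simpa only [Function.comp_def, append82_inr] using h'.comp Sum.inr Sum.inr_injective
    · simpa only [Function.comp_def, append82_inl, append82_inr] using
        h'.2 (i := Sum.inl i) (j := Sum.inr j) (by simp)
  · rintro ⟨h1, h2, h3⟩
    have h' : Orthonormal ℝ (append82 A v ∘ finSumFinEquiv (m := 8) (n := 2)) := by
      rw [orthonormal_iff_ite] at *
      rintro (i | i) (j | j) <;>
        simp only [Function.comp_def, append82_inl, append82_inr]
      · simpa using h1 i j
      · simpa using h3 i j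
      · simpa [real_inner_comm] using h3 j i
      · simpa using h2 i j
    simpa [Function.comp_def] using
      h'.comp _ (finSumFinEquiv (m := 8) (n := 2)).symm.injective

theorem orthonormal_pair_iff (p q : R10) :
    Orthonormal ℝ ![p, q] ↔ inner ℝ p p = (1 : ℝ) ∧ inner ℝ q q = (1 : ℝ) ∧
      inner ℝ p q = (0 : ℝ) := by
  rw [orthonormal_iff_ite]
  simp only [Fin.forall_fin_two]
  simp [real_inner_comm]
  tauto

/-! ### The 2-form of the complement of an oriented 8-plane -/

/-- The bivector `p ∧ q` as a skew matrix. -/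
def wedge (p q : R10) : Mat10 := Matrix.of fun k l => p k * q l - q k * p l

/-- The standard basis vectors of `ℝ¹⁰`. -/
noncomputable def stdVec (k : Fin 10) : R10 := EuclideanSpace.single k 1

theorem inner_stdVec (x : R10) (k : Fin 10) : inner ℝ x (stdVec k) = x k := by
  simp [stdVec, EuclideanSpace.inner_single_right]

theorem stdVec_inner (x : R10) (k : Fin 10) : inner ℝ (stdVec k) x = x k := by
  simp [stdVec, EuclideanSpace.inner_single_left]

theorem stdVec_apply (k l : Fin 10) : stdVec k l = if l = k then 1 else 0 := by
  simp [stdVec]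

/-- One half of Hodge duality. Multiplying by the determinant of the positive orthonormal basis,
which is 1, gives a Gram matrix that is block triangular with an identity block; only the $2\times2$
block survives. -/
theorem IsPosBasis.det_append_eq {A : Fin 8 → R10} {p q : R10}
    (h : IsPosBasis (append82 A ![p, q])) (x y : R10) :
    (rowMatrix (append82 A ![x, y])).det =
      inner ℝ x p * inner ℝ y q - inner ℝ x q * inner ℝ y p := by
  obtain ⟨hA, -, h0⟩ := (orthonormal_append82_iff _ _).1 h.1
  have e := det_append82_mul A A ![x, y] ![p, q]
  have e0 : gramOf A ![p, q] = 0 := by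
    ext i j; exact h0 i j
  rw [h.det_eq_one, mul_one, e0, (orthonormal_iff_gramOf A).1 hA, Matrix.det_fromBlocks_zero₁₂] at e
  rw [e, Matrix.det_one, one_mul, Matrix.det_fin_two]
  simp [gramOf]

/-- The dual half: here the block of $p,q$ against itself is the identity, and the remaining block
holds the coordinates of $A$ selected by $s$. -/
theorem IsPosBasis.minor_eq {A : Fin 8 → R10} {p q : R10}
    (h : IsPosBasis (append82 A ![p, q])) (s : Fin 8 → Fin 10) :
    (Matrix.of fun i j => A i (s j)).det =
      (rowMatrix (append82 (fun j => stdVec (s j)) ![p, q])).det := by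
  obtain ⟨-, hp, h0⟩ := (orthonormal_append82_iff _ _).1 h.1
  have e := det_append82_mul A (fun j => stdVec (s j)) ![p, q] ![p, q]
  have e0 : gramOf A ![p, q] = 0 := by
    ext i j; exact h0 i j
  rw [h.det_eq_one, one_mul, e0, (orthonormal_iff_gramOf _).1 hp, Matrix.det_fromBlocks_zero₁₂,
    Matrix.det_one, mul_one] at e
  rw [e]
  congr 1
  ext i j
  simp [gramOf, inner_stdVec]

theorem exists_perm_of_ne {k l : Fin 10} (h : k ≠ l) :
    ∃ σ : Equiv.Perm (Fin 10), σ 8 = k ∧ σ 9 = l := by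
  -- The first transposition sends 8 to $k$. The second sends the current image of 9 to $l$ and
  -- leaves $k$ alone, since $k$ is neither that image nor $l$.
  refine ⟨(Equiv.swap 8 k).trans (Equiv.swap (Equiv.swap 8 k 9) l) , ?_, ?_⟩
  · simp only [Equiv.trans_apply, Equiv.swap_apply_left]
    refine Equiv.swap_apply_of_ne_of_ne ?_ h
    intro e
    have : Equiv.swap 8 k 8 = Equiv.swap 8 k 9 := by rw [← e]; simp
    simpa using (Equiv.swap 8 k).injective this
  · simp

theorem append82_stdVec (σ : Fin 10 → Fin 10) :
    append82 (fun j => stdVec (σ (Fin.castAdd 2 j))) ![stdVec (σ 8), stdVec (σ 9)] =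
      fun i => stdVec (σ i) := by
  funext i
  refine Fin.addCases (m := 8) (n := 2) (fun i => ?_) (fun i => ?_) i
  · simp [append82]
  · fin_cases i <;> simp [append82] <;> rfl

/-- Laplace expansion along two rows that are basis vectors. Comparison with the permuted standard
basis, whose determinant is the sign of `σ`, leaves the complementary minor of $A$. -/
theorem det_append_stdVec (A : Fin 8 → R10) (σ : Equiv.Perm (Fin 10)) :
    (rowMatrix (append82 A ![stdVec (σ 8), stdVec (σ 9)])).det =
      (Equiv.Perm.sign σ : ℝ) * (Matrix.of fun i j => A i (σ (Fin.castAdd 2 j))).det := by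
  have e := det_append82_mul A (fun j => stdVec (σ (Fin.castAdd 2 j)))
    ![stdVec (σ 8), stdVec (σ 9)] ![stdVec (σ 8), stdVec (σ 9)]
  have e1 : gramOf ![stdVec (σ 8), stdVec (σ 9)] (fun j => stdVec (σ (Fin.castAdd 2 j))) = 0 := by
    ext i j
    fin_cases i <;>
      · simp only [gramOf, Matrix.of_apply, inner_stdVec]
        simp [stdVec_apply, Fin.ext_iff]
        omega
  have e2 : gramOf ![stdVec (σ 8), stdVec (σ 9)] ![stdVec (σ 8), stdVec (σ 9)] = 1 := by
    rw [← orthonormal_iff_gramOf, orthonormal_pair_iff]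
    simp only [inner_stdVec]
    simp [stdVec_apply]
  have e3 : (rowMatrix fun i => stdVec (σ i)).det = (Equiv.Perm.sign σ : ℝ) := by
    rw [← Matrix.det_permutation]
    congr 1
    ext i j
    simp [rowMatrix, stdVec_apply, PEquiv.toMatrix_apply, eq_comm]
  have e4 : gramOf A (fun j => stdVec (σ (Fin.castAdd 2 j))) =
      Matrix.of fun i j => A i (σ (Fin.castAdd 2 j)) := by
    ext i j
    simp [gramOf, inner_stdVec]
  rw [append82_stdVec, e1, e2, e3, e4, Matrix.det_fromBlocks_zero₂₁, Matrix.det_one, mul_one] at e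
  have hs : (Equiv.Perm.sign σ : ℝ) * (Equiv.Perm.sign σ : ℝ) = 1 := by
    rcases Int.units_eq_one_or (Equiv.Perm.sign σ) with h | h <;> simp [h]
  rw [← e, mul_left_comm, hs, mul_one]

/-- A permutation of the coordinates that moves the last two to given places. -/
noncomputable def permTo (k l : Fin 10) : Equiv.Perm (Fin 10) :=
  if h : k = l then 1 else (exists_perm_of_ne h).choose

/-- The 2-form of the orthogonal complement, in terms of the Plücker coordinates. -/
noncomputable def pluckerToForm (w : (Fin 8 → Fin 10) → ℝ) : Mat10 :=
  Matrix.of fun k l => if k = l then 0 else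
    (Equiv.Perm.sign (permTo k l) : ℝ) * w fun j => permTo k l (Fin.castAdd 2 j)

/-- The Plücker coordinates, in terms of the 2-form of the orthogonal complement. -/
noncomputable def formToPlucker (F : Mat10) : (Fin 8 → Fin 10) → ℝ := fun s =>
  2⁻¹ * ∑ k, ∑ l, F k l *
    (rowMatrix (append82 (fun j => stdVec (s j)) ![stdVec k, stdVec l])).det

theorem IsPosBasis.pluckerToForm_eq {A : Fin 8 → R10} {p q : R10}
    (h : IsPosBasis (append82 A ![p, q])) :
    pluckerToForm (fun s => (Matrix.of fun i j => A i (s j)).det) = wedge p q := by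
  ext k l
  by_cases hkl : k = l
  · simp [pluckerToForm, wedge, hkl, mul_comm]
  · have hs := (exists_perm_of_ne hkl).choose_spec
    have hσ : permTo k l = (exists_perm_of_ne hkl).choose := by simp [permTo, hkl]
    rw [← hσ] at hs
    simp only [pluckerToForm, Matrix.of_apply, if_neg hkl]
    rw [← det_append_stdVec, hs.1, hs.2, h.det_append_eq]
    simp only [stdVec_inner, wedge, Matrix.of_apply]

/-- The determinant as a bilinear function of its last two rows. -/
noncomputable def detBilin (B : Fin 8 → R10) (x y : R10) : ℝ :=
  (rowMatrix (append82 B ![x, y])).det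

theorem rowMatrix_append82 (B : Fin 8 → R10) (x y : R10) :
    rowMatrix (append82 B ![x, y]) =
      ((rowMatrix (append82 B ![0, 0])).updateRow 8 x.ofLp).updateRow 9 y.ofLp := by
  ext i k
  refine Fin.addCases (m := 8) (n := 2) (fun i => ?_) (fun i => ?_) i
  · have h1 : Fin.castAdd 2 i ≠ (8 : Fin 10) := by intro h; simp [Fin.ext_iff] at h; omega
    have h2 : Fin.castAdd 2 i ≠ (9 : Fin 10) := by intro h; simp [Fin.ext_iff] at h; omega
    rw [Matrix.updateRow_ne h2, Matrix.updateRow_ne h1]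
    simp [rowMatrix, append82]
  · fin_cases i
    · change rowMatrix _ (Fin.natAdd 8 0) k = Matrix.updateRow _ 9 _ 8 k
      rw [Matrix.updateRow_ne (by decide), Matrix.updateRow_self]
      simp [rowMatrix]
    · change rowMatrix _ (Fin.natAdd 8 1) k = Matrix.updateRow _ 9 _ 9 k
      rw [Matrix.updateRow_self]
      simp [rowMatrix]

/-- Linearity in one row, obtained from the linearity of the Cramer map of the transpose. -/
theorem det_updateRow_expand {n : Type*} [Fintype n] [DecidableEq n] (M : Matrix n n ℝ) (i : n)
    (y : n → ℝ) : (M.updateRow i y).det = ∑ l, y l * (M.updateRow i (Pi.single l 1)).det := by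
  have hy : y = ∑ l, y l • (Pi.single l 1 : n → ℝ) := by
    ext j; simp [Finset.sum_apply, Pi.single_apply]
  simp only [← Matrix.cramer_transpose_apply]
  conv_lhs => rw [hy, map_sum, Finset.sum_apply]
  simp only [map_smul, Pi.smul_apply, smul_eq_mul]

theorem detBilin_expand_right (B : Fin 8 → R10) (x y : R10) :
    detBilin B x y = ∑ l, y l * detBilin B x (stdVec l) := by
  have e : ∀ z : R10, detBilin B x z = (Matrix.updateRow
      ((rowMatrix (append82 B ![0, 0])).updateRow 8 x.ofLp) 9 z.ofLp).det := fun z =>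
    congrArg Matrix.det (rowMatrix_append82 B x z)
  simp only [e]
  exact det_updateRow_expand _ _ _

theorem detBilin_swap (B : Fin 8 → R10) (x y : R10) : detBilin B x y = - detBilin B y x := by
  have h := Matrix.det_permute (Equiv.swap (8 : Fin 10) 9) (rowMatrix (append82 B ![x, y]))
  rw [Equiv.Perm.sign_swap (by decide)] at h
  have e : (rowMatrix (append82 B ![x, y])).submatrix (Equiv.swap (8 : Fin 10) 9) id =
      rowMatrix (append82 B ![y, x]) := by
    ext i k
    refine Fin.addCases (m := 8) (n := 2) (fun i => ?_) (fun i => ?_) i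
    · have h1 : Fin.castAdd 2 i ≠ (8 : Fin 10) := by intro h; simp [Fin.ext_iff] at h; omega
      have h2 : Fin.castAdd 2 i ≠ (9 : Fin 10) := by intro h; simp [Fin.ext_iff] at h; omega
      rw [Matrix.submatrix_apply, Equiv.swap_apply_of_ne_of_ne h1 h2]
      simp [rowMatrix, append82]
    · fin_cases i
      · change rowMatrix _ (Equiv.swap (8 : Fin 10) 9 8) k = rowMatrix _ (Fin.natAdd 8 0) k
        rw [Equiv.swap_apply_left]
        change rowMatrix _ (Fin.natAdd 8 1) k = _
        simp [rowMatrix]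
      · change rowMatrix _ (Equiv.swap (8 : Fin 10) 9 9) k = rowMatrix _ (Fin.natAdd 8 1) k
        rw [Equiv.swap_apply_right]
        change rowMatrix _ (Fin.natAdd 8 0) k = _
        simp [rowMatrix]
  rw [e] at h
  simp only [detBilin, h]
  simp

theorem detBilin_expand (B : Fin 8 → R10) (x y : R10) :
    detBilin B x y = ∑ k, ∑ l, x k * y l * detBilin B (stdVec k) (stdVec l) := by
  rw [detBilin_expand_right, Finset.sum_comm]
  refine Finset.sum_congr rfl fun l _ => ?_
  rw [detBilin_swap, detBilin_expand_right, ← Finset.sum_neg_distrib, Finset.mul_sum]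
  refine Finset.sum_congr rfl fun k _ => ?_
  rw [detBilin_swap B (stdVec k)]
  ring

theorem formToPlucker_wedge (p q : R10) (s : Fin 8 → Fin 10) :
    formToPlucker (wedge p q) s = detBilin (fun j => stdVec (s j)) p q := by
  have h1 := detBilin_expand (fun j => stdVec (s j)) p q
  have h2 := detBilin_expand (fun j => stdVec (s j)) q p
  rw [detBilin_swap] at h2
  -- The sum runs over ordered pairs, so each coordinate plane is counted twice; this is what the
  -- factor $2^{-1}$ in `formToPlucker` corrects.
  have h3 : ∑ k, ∑ l, wedge p q k l * detBilin (fun j => stdVec (s j)) (stdVec k) (stdVec l) =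
      detBilin (fun j => stdVec (s j)) p q + detBilin (fun j => stdVec (s j)) p q := by
    nth_rw 1 [h1]
    rw [← neg_neg (detBilin _ p q), h2, ← sub_eq_add_neg, ← Finset.sum_sub_distrib]
    refine Finset.sum_congr rfl fun k _ => ?_
    rw [← Finset.sum_sub_distrib]
    refine Finset.sum_congr rfl fun l _ => ?_
    simp only [wedge, Matrix.of_apply]
    ring
  change 2⁻¹ * (∑ k, ∑ l, wedge p q k l * detBilin _ (stdVec k) (stdVec l)) = _
  rw [h3]
  ring

theorem IsPosBasis.formToPlucker_eq {A : Fin 8 → R10} {p q : R10}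
    (h : IsPosBasis (append82 A ![p, q])) :
    formToPlucker (wedge p q) = fun s => (Matrix.of fun i j => A i (s j)).det := by
  funext s
  rw [formToPlucker_wedge, h.minor_eq, detBilin]

/-! ### Existence of complements -/

theorem det_rowMatrix_append82_neg (A : Fin 8 → R10) (p q : R10)
    (h : Orthonormal ℝ (append82 A ![p, q])) :
    (rowMatrix (append82 A ![p, -q])).det * (rowMatrix (append82 A ![p, q])).det = -1 := by
  obtain ⟨hA, hp, h0⟩ := (orthonormal_append82_iff _ _).1 h
  have e0 : gramOf A ![p, q] = 0 := by
    ext i j; exact h0 i j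
  obtain ⟨h1, h2, h3⟩ := (orthonormal_pair_iff _ _).1 hp
  rw [det_append82_mul, (orthonormal_iff_gramOf _).1 hA, e0, Matrix.det_fromBlocks_zero₁₂,
    Matrix.det_one, one_mul, Matrix.det_fin_two]
  change inner ℝ p p * inner ℝ (-q) q - inner ℝ p q * inner ℝ (-q) p = (-1 : ℝ)
  rw [inner_neg_left, h1, h2, h3]
  ring

theorem det_rowMatrix_append82_swap (A : Fin 8 → R10) (v : Fin 2 → R10)
    (h : Orthonormal ℝ (append82 A v)) :
    (rowMatrix (append82 (A ∘ Equiv.swap 0 1) v)).det * (rowMatrix (append82 A v)).det = -1 := by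
  obtain ⟨hA, hv, h0⟩ := (orthonormal_append82_iff _ _).1 h
  have e0 : gramOf v A = 0 := by
    ext i j; exact (real_inner_comm _ _).trans (h0 j i)
  have e1 : gramOf (A ∘ Equiv.swap 0 1) A = (gramOf A A).submatrix (Equiv.swap 0 1) id := rfl
  rw [det_append82_mul, (orthonormal_iff_gramOf _).1 hv, e0, Matrix.det_fromBlocks_zero₂₁,
    Matrix.det_one, mul_one, e1, Matrix.det_permute, (orthonormal_iff_gramOf _).1 hA,
    Equiv.Perm.sign_swap (by decide)]
  simp

theorem exists_orthonormal_append82_of_frame {A : Fin 8 → R10} (hA : Orthonormal ℝ A) :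
    ∃ p q, Orthonormal ℝ (append82 A ![p, q]) := by
  have hs : Orthonormal ℝ ((Set.range (Sum.inl : Fin 8 → Fin 8 ⊕ Fin 2)).domRestrict
      (Sum.elim A 0)) := by
    rw [orthonormal_iff_ite] at hA ⊢
    rintro ⟨_, i, rfl⟩ ⟨_, j, rfl⟩
    simpa [Subtype.ext_iff] using hA i j
  obtain ⟨b, hb⟩ := Orthonormal.exists_orthonormalBasis_extension_of_card_eq (by simp) hs
  refine ⟨b (Sum.inr 0), b (Sum.inr 1), (orthonormal_append82_iff _ _).2
    ⟨hA, (orthonormal_pair_iff _ _).2 ⟨?_, ?_, ?_⟩, fun i j => ?_⟩⟩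
  · simp
  · simp
  · simp
  · have := hb (Sum.inl i) ⟨i, rfl⟩
    rw [Sum.elim_inl] at this
    rw [← this]
    fin_cases j <;> simp

theorem exists_orthonormal_append82_of_pair {v : Fin 2 → R10} (hv : Orthonormal ℝ v) :
    ∃ A, Orthonormal ℝ (append82 A v) := by
  have hs : Orthonormal ℝ ((Set.range (Sum.inr : Fin 2 → Fin 8 ⊕ Fin 2)).domRestrict
      (Sum.elim 0 v)) := by
    rw [orthonormal_iff_ite] at hv ⊢
    rintro ⟨_, i, rfl⟩ ⟨_, j, rfl⟩
    simpa [Subtype.ext_iff] using hv i j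
  obtain ⟨b, hb⟩ := Orthonormal.exists_orthonormalBasis_extension_of_card_eq (by simp) hs
  refine ⟨fun i => b (Sum.inl i), (orthonormal_append82_iff _ _).2
    ⟨b.orthonormal.comp _ Sum.inl_injective, hv, fun i j => ?_⟩⟩
  have := hb (Sum.inr j) ⟨j, rfl⟩
  rw [Sum.elim_inr] at this
  rw [← this]
  simp

/-- Extend a frame of $W$ to an orthonormal basis; if it is negative, replace $q$ by $-q$. -/
theorem exists_posCompl (W : Gr 8) : ∃ p q, PosCompl W p q := by
  obtain ⟨A, rfl⟩ := Quotient.exists_rep W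
  obtain ⟨p, q, h⟩ := exists_orthonormal_append82_of_frame A.2
  have hd := det_rowMatrix_append82_neg A.1 p q h
  by_cases hpos : 0 < (rowMatrix (append82 A.1 ![p, q])).det
  · exact ⟨p, q, A, rfl, h, hpos⟩
  · refine ⟨p, -q, A, rfl, ?_, ?_⟩
    · obtain ⟨h1, h2, h3⟩ := (orthonormal_append82_iff _ _).1 h
      rw [orthonormal_pair_iff] at h2
      refine (orthonormal_append82_iff _ _).2 ⟨h1, (orthonormal_pair_iff _ _).2 ?_, fun i j => ?_⟩
      · simpa using h2
      · have h4 := h3 i 0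
        have h5 := h3 i 1
        fin_cases j <;> simp_all
    · change 0 < (rowMatrix (append82 A.1 ![p, -q])).det
      nlinarith

/-- The pair is prescribed, so a wrong orientation is repaired inside the 8-frame, by exchanging its
first two vectors. -/
theorem exists_posCompl_of_orthonormal {p q : R10} (h : Orthonormal ℝ ![p, q]) :
    ∃ W, PosCompl W p q := by
  obtain ⟨A, hA⟩ := exists_orthonormal_append82_of_pair h
  have hA' := (orthonormal_append82_iff _ _).1 hA
  have hd := det_rowMatrix_append82_swap A _ hA
  by_cases hpos : 0 < (rowMatrix (append82 A ![p, q])).det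
  · exact ⟨_, ⟨A, hA'.1⟩, rfl, hA, hpos⟩
  · have h2 : Orthonormal ℝ (A ∘ Equiv.swap 0 1) := hA'.1.comp _ (Equiv.injective _)
    refine ⟨_, ⟨_, h2⟩, rfl, (orthonormal_append82_iff _ _).2 ⟨h2, h, fun i j => hA'.2.2 _ j⟩, ?_⟩
    change 0 < (rowMatrix (append82 (A ∘ Equiv.swap 0 1) ![p, q])).det
    nlinarith

/-! ### The form of an oriented 8-plane -/

/-- The bivector of the positively oriented orthogonal complement. -/
noncomputable def Gr.form (W : Gr 8) : Mat10 := pluckerToForm W.plucker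

theorem PosCompl.form_eq {W : Gr 8} {p q : R10} (h : PosCompl W p q) : W.form = wedge p q := by
  obtain ⟨A, rfl, h⟩ := h
  exact h.pluckerToForm_eq

theorem PosCompl.orthonormal {W : Gr 8} {p q : R10} (h : PosCompl W p q) :
    Orthonormal ℝ ![p, q] := by
  obtain ⟨A, rfl, h⟩ := h
  exact ((orthonormal_append82_iff _ _).1 h.1).2.1

theorem Gr.formToPlucker_form (W : Gr 8) : formToPlucker W.form = W.plucker := by
  obtain ⟨p, q, h⟩ := exists_posCompl W
  rw [h.form_eq]
  obtain ⟨A, rfl, h⟩ := h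
  exact h.formToPlucker_eq

theorem matAct_wedge (p q x : R10) :
    matAct (wedge p q) x = (inner ℝ q x : ℝ) • p - (inner ℝ p x : ℝ) • q := by
  ext k
  simp only [matAct, wedge, Matrix.mulVec, dotProduct, Matrix.of_apply, PiLp.sub_apply,
    PiLp.smul_apply, smul_eq_mul, inner_eq_sum, Finset.sum_mul, ← Finset.sum_sub_distrib]
  exact Finset.sum_congr rfl fun l _ => by ring

theorem matAct_wedge_right {p q : R10} (h : Orthonormal ℝ ![p, q]) :
    matAct (wedge p q) q = p := by
  obtain ⟨h1, h2, h3⟩ := (orthonormal_pair_iff _ _).1 h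
  rw [matAct_wedge, h2, h3]; simp

theorem matAct_wedge_left {p q : R10} (h : Orthonormal ℝ ![p, q]) :
    matAct (wedge p q) p = -q := by
  obtain ⟨h1, h2, h3⟩ := (orthonormal_pair_iff _ _).1 h
  rw [matAct_wedge, h1, real_inner_comm, h3]; simp

theorem eq_sum_of_orthonormal_append82 {A : Fin 8 → R10} {p q : R10}
    (h : Orthonormal ℝ (append82 A ![p, q])) (x : R10) :
    x = ∑ i, (inner ℝ (A i) x : ℝ) • A i + (inner ℝ p x : ℝ) • p + (inner ℝ q x : ℝ) • q := by
  have hs : ⊤ ≤ Submodule.span ℝ (Set.range (append82 A ![p, q])) := by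
    rw [h.linearIndependent.span_eq_top_of_card_eq_finrank (by simp)]
  have := (OrthonormalBasis.mk h hs).sum_repr' x
  simp only [OrthonormalBasis.coe_mk] at this
  rw [← (finSumFinEquiv (m := 8) (n := 2)).sum_comp, Fintype.sum_sum_type] at this
  simp only [append82_inl, append82_inr, Fin.sum_univ_two] at this
  rw [add_assoc]
  exact this.symm

/-- Equal bivectors give equal complementary planes, since the plane is the image of the operator.
The two 8-frames then span the same space, and their transition matrix is shown to be special
orthogonal. -/
theorem Gr.form_injective : Function.Injective Gr.form := by
  intro W W' e
  obtain ⟨p, q, h⟩ := exists_posCompl W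
  obtain ⟨p', q', h'⟩ := exists_posCompl W'
  rw [h.form_eq, h'.form_eq] at e
  have ho := h.orthonormal
  -- Write $p=Fq$ with $F=p\wedge q$ and evaluate the same $F$ as $p'\wedge q'$; likewise $q=-Fp$.
  have hp : p = (inner ℝ q' q : ℝ) • p' - (inner ℝ p' q : ℝ) • q' := by
    rw [← matAct_wedge, ← e, matAct_wedge_right ho]
  have hq : q = -((inner ℝ q' p : ℝ) • p' - (inner ℝ p' p : ℝ) • q') := by
    rw [← matAct_wedge, ← e, matAct_wedge_left ho, neg_neg]
  obtain ⟨A, rfl, h⟩ := h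
  obtain ⟨A', rfl, h'⟩ := h'
  change IsPosBasis (append82 A.1 ![p, q]) at h
  change IsPosBasis (append82 A'.1 ![p', q']) at h'
  obtain ⟨-, hpq', h0'⟩ := (orthonormal_append82_iff _ _).1 h'.1
  have hAp' : ∀ i, inner ℝ (A'.1 i) p' = (0 : ℝ) := fun i => h0' i 0
  have hAq' : ∀ i, inner ℝ (A'.1 i) q' = (0 : ℝ) := fun i => h0' i 1
  have hAp : ∀ i, inner ℝ (A'.1 i) p = (0 : ℝ) := fun i => by
    rw [hp, inner_sub_right, inner_smul_right, inner_smul_right, hAp', hAq']; simp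
  have hAq : ∀ i, inner ℝ (A'.1 i) q = (0 : ℝ) := fun i => by
    rw [hq, inner_neg_right, inner_sub_right, inner_smul_right, inner_smul_right, hAp', hAq']; simp
  have hrow : rowMatrix A'.1 = gramOf A'.1 A.1 * rowMatrix A.1 := by
    ext i k
    have := congrArg (fun z : R10 => z k) (eq_sum_of_orthonormal_append82 h.1 (A'.1 i))
    simp only [real_inner_comm (A'.1 i), hAp, hAq] at this
    simpa [rowMatrix, gramOf, Matrix.mul_apply] using this
  -- This determinant equals that of $(A',p,q)$, which is $\langle p,p'\rangle\langle
  -- q,q'\rangle-\langle p,q'\rangle\langle q,p'\rangle$. By `hp` the latter is $\langle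
  -- p,p\rangle=1$.
  have hdet : (gramOf A'.1 A.1).det = 1 := by
    have e1 := det_append82_mul A'.1 A.1 ![p, q] ![p, q]
    have e0 : gramOf A'.1 ![p, q] = 0 := by
      ext i j
      fin_cases j
      · exact hAp i
      · exact hAq i
    rw [h.det_eq_one, mul_one, e0, (orthonormal_iff_gramOf _).1 ho, Matrix.det_fromBlocks_zero₁₂,
      Matrix.det_one, mul_one] at e1
    rw [← e1, h'.det_append_eq]
    have e2 := ((orthonormal_pair_iff _ _).1 ho).1
    nth_rw 2 [hp] at e2
    rw [inner_sub_right, inner_smul_right, inner_smul_right] at e2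
    rw [← e2, real_inner_comm q q', real_inner_comm q p']
    ring
  refine Quotient.sound ⟨gramOf A'.1 A.1, ?_, fun i => ?_⟩
  · rw [Matrix.mem_specialOrthogonalGroup_iff, Matrix.mem_orthogonalGroup_iff]
    refine ⟨?_, hdet⟩
    have e1 := (orthonormal_iff_gramOf _).1 A'.2
    rw [← rowMatrix_mul_transpose, hrow, Matrix.transpose_mul, Matrix.mul_assoc,
      ← Matrix.mul_assoc (rowMatrix A.1), rowMatrix_mul_transpose,
      (orthonormal_iff_gramOf _).1 A.2, Matrix.one_mul] at e1
    exact e1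
  · ext k
    have := congrFun (congrFun hrow i) k
    simpa [rowMatrix, Matrix.mul_apply] using this

/-- The working form of `PosCompl`: it removes the frame of $W$, so changes of basis in $W^\perp$
become identities between bivectors. -/
theorem posCompl_iff {W : Gr 8} {p q : R10} :
    PosCompl W p q ↔ Orthonormal ℝ ![p, q] ∧ W.form = wedge p q := by
  refine ⟨fun h => ⟨h.orthonormal, h.form_eq⟩, fun ⟨h, e⟩ => ?_⟩
  obtain ⟨W', h'⟩ := exists_posCompl_of_orthonormal h
  rwa [Gr.form_injective (e.trans h'.form_eq.symm)]

/-! ### Topology of the Grassmannian -/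

theorem isClosed_setOf_orthonormal (k : ℕ) : IsClosed {A : Fin k → R10 | Orthonormal ℝ A} := by
  simp only [orthonormal_iff_ite, Set.ofPred_forall]
  refine isClosed_iInter fun i => isClosed_iInter fun j => isClosed_eq ?_ continuous_const
  fun_prop

instance (k : ℕ) : CompactSpace (Frame k) := by
  refine isCompact_iff_compactSpace.1 (Metric.isCompact_of_isClosed_isBounded
    (isClosed_setOf_orthonormal k) ?_)
  refine (Metric.isBounded_closedBall (x := (0 : Fin k → R10)) (r := 1)).subset fun A hA => ?_
  rw [mem_closedBall_zero_iff, pi_norm_le_iff_of_nonneg zero_le_one]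
  exact fun i => (hA.1 i).le

instance (k : ℕ) : CompactSpace (Gr k) :=
  inferInstanceAs (CompactSpace (Quotient (frameSetoid k)))

theorem Gr.continuous_plucker : Continuous (Gr.plucker (k := 8)) := by
  have hq : Topology.IsQuotientMap (Gr.mk (k := 8)) := isQuotientMap_quot_mk
  refine hq.continuous_iff.2 ?_
  change Continuous fun (A : Frame 8) (s : Fin 8 → Fin 10) =>
    (Matrix.of fun i j => A.1 i (s j)).det
  refine continuous_pi fun s => Continuous.matrix_det ?_
  refine continuous_matrix fun i j => ?_
  exact (PiLp.continuous_apply 2 _ (s j)).comp ((continuous_apply i).comp continuous_subtype_val)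

theorem continuous_pluckerToForm : Continuous pluckerToForm := by
  refine continuous_matrix fun k l => ?_
  simp only [pluckerToForm, Matrix.of_apply]
  split_ifs <;> fun_prop

/-- An injective continuous map from a compact space to a Hausdorff space. The Hausdorff property of
the Grassmannian is then inherited from matrices, and continuity of maps into it is tested on
bivectors. -/
theorem Gr.isClosedEmbedding_form : Topology.IsClosedEmbedding Gr.form :=
  (continuous_pluckerToForm.comp Gr.continuous_plucker).isClosedEmbedding Gr.form_injective

instance : T2Space (Gr 8) := Gr.isClosedEmbedding_form.isEmbedding.t2Space

/-- The oriented 8-plane with a given oriented orthogonal complement. -/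
noncomputable def Gr.compl (v : Frame 2) : Gr 8 :=
  (exists_posCompl_of_orthonormal (p := v.1 0) (q := v.1 1) (by
    convert v.2 using 1; ext i; fin_cases i <;> rfl)).choose

theorem Gr.posCompl_compl (v : Frame 2) : PosCompl (Gr.compl v) (v.1 0) (v.1 1) :=
  (exists_posCompl_of_orthonormal (p := v.1 0) (q := v.1 1) (by
    convert v.2 using 1; ext i; fin_cases i <;> rfl)).choose_spec

theorem continuous_wedge : Continuous fun v : R10 × R10 => wedge v.1 v.2 := by
  refine continuous_matrix fun k l => ?_
  simp only [wedge, Matrix.of_apply]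
  fun_prop

theorem Gr.continuous_compl : Continuous Gr.compl := by
  rw [Gr.isClosedEmbedding_form.isEmbedding.continuous_iff]
  have : Gr.form ∘ Gr.compl = fun v => wedge (v.1 0) (v.1 1) :=
    funext fun v => (Gr.posCompl_compl v).form_eq
  rw [this]
  exact continuous_wedge.comp (f := fun v : Frame 2 => (v.1 0, v.1 1))
    (((continuous_apply 0).comp continuous_subtype_val).prodMk
      ((continuous_apply 1).comp continuous_subtype_val))

theorem PosCompl.eq_compl {W : Gr 8} {p q : R10} (h : PosCompl W p q) :
    W = Gr.compl ⟨![p, q], h.orthonormal⟩ :=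
  Gr.form_injective (h.form_eq.trans (Gr.posCompl_compl ⟨![p, q], h.orthonormal⟩).form_eq.symm)

/-! ### The diffeomorphism with the quadric -/

theorem complexVec_apply (p q : R10) (k : Fin 10) :
    complexVec p q k = (p k : ℂ) + Complex.I * (q k : ℂ) := rfl

theorem complexVec_re (p q : R10) (k : Fin 10) : (complexVec p q k).re = p k := by
  simp [complexVec_apply]

theorem complexVec_im (p q : R10) (k : Fin 10) : (complexVec p q k).im = q k := by
  simp [complexVec_apply]

theorem complexVec_ne_zero {p q : R10} (h : p ≠ 0) : complexVec p q ≠ 0 := by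
  intro e
  apply h
  ext k
  rw [← complexVec_re p q, e]
  simp

theorem norm_sq_complexVec (p q : R10) :
    ‖complexVec p q‖ ^ 2 = inner ℝ p p + inner ℝ q q := by
  rw [EuclideanSpace.norm_sq_eq, inner_eq_sum, inner_eq_sum, ← Finset.sum_add_distrib]
  refine Finset.sum_congr rfl fun k _ => ?_
  rw [Complex.sq_norm, Complex.normSq_apply, complexVec_re, complexVec_im]

theorem sum_sq_complexVec (p q : R10) :
    ∑ k, complexVec p q k ^ 2 =
      ((inner ℝ p p - inner ℝ q q : ℝ) : ℂ) + ((2 * inner ℝ p q : ℝ) : ℂ) * Complex.I := by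
  simp only [inner_eq_sum, Finset.mul_sum, ← Finset.sum_sub_distrib, Complex.ofReal_sum,
    Finset.sum_mul, ← Finset.sum_add_distrib]
  refine Finset.sum_congr rfl fun k _ => ?_
  rw [complexVec_apply]
  push_cast
  linear_combination (q k : ℂ) ^ 2 * Complex.I_sq

theorem left_ne_zero_of_orthonormal {p q : R10} (h : Orthonormal ℝ ![p, q]) : p ≠ 0 :=
  h.ne_zero 0

/-- The operator that sends the `l`-th basis vector to the `k`-th one. -/
noncomputable def elemOp (k l : Fin 10) : C10 →L[ℂ] C10 :=
  (EuclideanSpace.proj l : C10 →L[ℂ] ℂ).smulRight (EuclideanSpace.single k 1)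

theorem elemOp_apply (k' l : Fin 10) (w : C10) (k : Fin 10) :
    elemOp k' l w k = if k = k' then w l else 0 := by
  simp [elemOp]

/-- The orthogonal projection onto the line spanned by `p + i q`, in terms of `p ∧ q`. -/
noncomputable def formToProj (F : Mat10) : C10 →L[ℂ] C10 :=
  ∑ k, ∑ l, ((-2⁻¹ * ∑ m, F k m * F m l : ℝ) • elemOp k l +
    (-2⁻¹ * F k l : ℝ) • (Complex.I • elemOp k l))

/-- The bivector `p ∧ q`, in terms of the orthogonal projection onto the line spanned by
`p + i q`. -/
noncomputable def projToForm (T : C10 →L[ℂ] C10) : Mat10 :=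
  Matrix.of fun k l => -2 * (T (EuclideanSpace.single l 1) k).im

theorem wedge_mul_wedge_apply {p q : R10} (h : Orthonormal ℝ ![p, q]) (k l : Fin 10) :
    ∑ m, wedge p q k m * wedge p q m l = -(p k * p l + q k * q l) := by
  obtain ⟨h1, h2, h3⟩ := (orthonormal_pair_iff _ _).1 h
  rw [inner_eq_sum] at h1 h2 h3
  have : ∀ m, wedge p q k m * wedge p q m l = (p k * q l + q k * p l) * (p m * q m) -
      p k * p l * (q m * q m) - q k * q l * (p m * p m) := fun m => by
    simp only [wedge, Matrix.of_apply]; ring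
  simp only [this, Finset.sum_sub_distrib, ← Finset.mul_sum, h1, h2, h3]
  ring

theorem projOnto_apply {p q : R10} (h : Orthonormal ℝ ![p, q]) {z : ℙ ℂ C10}
    (hz : z.submodule = Submodule.span ℂ {complexVec p q}) (w : C10) :
    projOnto z w = ((inner ℂ (complexVec p q) w) / 2 : ℂ) • complexVec p q := by
  obtain ⟨h1, h2, -⟩ := (orthonormal_pair_iff _ _).1 h
  have h4 := norm_sq_complexVec p q
  rw [h1, h2] at h4
  simp only [projOnto, hz]
  rw [Submodule.starProjection_singleton]
  congr 2
  rw [h4]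
  norm_num

/-- The projector has entries $\tfrac12(p_k+iq_k)(p_l-iq_l)$. The real part is $-\tfrac12$ of the
square of the bivector, by `wedge_mul_wedge_apply`, and the imaginary part is $-\tfrac12$ of the
bivector itself. -/
theorem formToProj_wedge {p q : R10} (h : Orthonormal ℝ ![p, q]) {z : ℙ ℂ C10}
    (hz : z.submodule = Submodule.span ℂ {complexVec p q}) :
    formToProj (wedge p q) = projOnto z := by
  ext w k
  rw [projOnto_apply h hz]
  have e : ∀ (c d : ℝ) (k' l : Fin 10), ((c • elemOp k' l + d • (Complex.I • elemOp k' l)) w) k =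
      if k = k' then ((c : ℂ) + d * Complex.I) * w l else 0 := by
    intro c d k' l
    simp only [elemOp_apply, add_apply, PiLp.add_apply, smul_apply, PiLp.smul_apply]
    split_ifs <;> simp
    ring
  simp only [formToProj, sum_apply, WithLp.ofLp_sum, Finset.sum_apply, e, wedge_mul_wedge_apply h]
  rw [Finset.sum_eq_single k (by simp +contextual [eq_comm]) (by simp)]
  simp only [if_true, PiLp.smul_apply, smul_eq_mul, PiLp.inner_apply, Finset.sum_div,
    Finset.sum_mul]
  refine Finset.sum_congr rfl fun l _ => ?_
  simp only [RCLike.inner_apply, complexVec_apply, wedge, Matrix.of_apply, map_add, map_mul,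
    Complex.conj_ofReal, Complex.conj_I]
  push_cast
  linear_combination ((q k : ℂ) * q l * w l / 2) * Complex.I_sq

theorem projToForm_projOnto {p q : R10} (h : Orthonormal ℝ ![p, q]) {z : ℙ ℂ C10}
    (hz : z.submodule = Submodule.span ℂ {complexVec p q}) :
    projToForm (projOnto z) = wedge p q := by
  ext k l
  simp only [projToForm, Matrix.of_apply, projOnto_apply h hz, wedge, PiLp.smul_apply]
  simp [EuclideanSpace.inner_single_right, complexVec_apply]
  ring

/-! ### Smoothness of the coordinate changes -/

section
variable {E : Type*} [NormedAddCommGroup E] [NormedSpace ℝ E]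

theorem contDiff_formToProj {F : E → Mat10} (hF : ∀ k l, ContDiff ℝ ∞ fun x => F x k l) :
    ContDiff ℝ ∞ fun x => formToProj (F x) := by
  simp only [formToProj]
  fun_prop

theorem contDiff_formToPlucker {F : E → Mat10} (hF : ∀ k l, ContDiff ℝ ∞ fun x => F x k l) :
    ContDiff ℝ ∞ fun x => formToPlucker (F x) := by
  refine contDiff_pi.2 fun s => ?_
  simp only [formToPlucker]
  fun_prop

theorem contDiff_pluckerToForm (k l : Fin 10) : ContDiff ℝ ∞ fun w => pluckerToForm w k l := by
  simp only [pluckerToForm, Matrix.of_apply]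
  split_ifs <;> fun_prop

theorem contDiff_projToForm (k l : Fin 10) : ContDiff ℝ ∞ fun T => projToForm T k l := by
  simp only [projToForm, Matrix.of_apply]
  refine contDiff_const.mul ?_
  exact ((Complex.imCLM.comp ((EuclideanSpace.proj k : C10 →L[ℂ] ℂ).restrictScalars ℝ)).comp
    ((ContinuousLinearMap.apply ℂ C10 (EuclideanSpace.single l (1 : ℂ))).restrictScalars ℝ)).contDiff

end

/-- The point `[p + i q]` of the quadric. -/
noncomputable def quadricPoint (p q : R10) (h : Orthonormal ℝ ![p, q]) : Q8 :=
  ⟨Projectivization.mk ℂ (complexVec p q) (complexVec_ne_zero (left_ne_zero_of_orthonormal h)), by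
    intro v hv
    rw [Projectivization.submodule_mk, Submodule.mem_span_singleton] at hv
    obtain ⟨a, rfl⟩ := hv
    obtain ⟨h1, h2, h3⟩ := (orthonormal_pair_iff _ _).1 h
    simp only [PiLp.smul_apply, smul_eq_mul, mul_pow, ← Finset.mul_sum, sum_sq_complexVec, h1, h2,
      h3]
    simp⟩

/-- The point of the quadric corresponding to an oriented 8-plane. -/
noncomputable def Gr.toQuadric (W : Gr 8) : Q8 :=
  quadricPoint (exists_posCompl W).choose (exists_posCompl W).choose_spec.choose
    (exists_posCompl W).choose_spec.choose_spec.orthonormal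

theorem projOnto_injective : Function.Injective projOnto := by
  intro z z' h
  apply Projectivization.submodule_injective
  rw [← Submodule.range_starProjection z.submodule, ← Submodule.range_starProjection z'.submodule]
  exact congrArg (fun T : C10 →L[ℂ] C10 => LinearMap.range (T : C10 →ₗ[ℂ] C10)) h

theorem Gr.projOnto_toQuadric (W : Gr 8) :
    projOnto (W.toQuadric : ℙ ℂ C10) = formToProj W.form := by
  have h := (exists_posCompl W).choose_spec.choose_spec
  rw [h.form_eq]
  exact (formToProj_wedge h.orthonormal (Projectivization.submodule_mk _ _)).symm

theorem Gr.projToForm_toQuadric (W : Gr 8) :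
    projToForm (projOnto (W.toQuadric : ℙ ℂ C10)) = W.form := by
  have h := (exists_posCompl W).choose_spec.choose_spec
  rw [h.form_eq]
  exact projToForm_projOnto h.orthonormal (Projectivization.submodule_mk _ _)

theorem PosCompl.submodule_toQuadric {W : Gr 8} {p q : R10} (h : PosCompl W p q) :
    (W.toQuadric : ℙ ℂ C10).submodule = Submodule.span ℂ {complexVec p q} := by
  have e : (W.toQuadric : ℙ ℂ C10) = quadricPoint p q h.orthonormal := by
    apply projOnto_injective
    rw [Gr.projOnto_toQuadric, h.form_eq]
    exact formToProj_wedge h.orthonormal (Projectivization.submodule_mk _ _)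
  rw [e]
  exact Projectivization.submodule_mk _ _

/-- The real part of a complex vector. -/
noncomputable def reVec (v : C10) : R10 := WithLp.toLp 2 fun k => (v k).re

/-- The imaginary part of a complex vector. -/
noncomputable def imVec (v : C10) : R10 := WithLp.toLp 2 fun k => (v k).im

theorem complexVec_reVec_imVec (v : C10) : complexVec (reVec v) (imVec v) = v := by
  ext k
  rw [complexVec_apply, mul_comm]
  exact Complex.re_add_im _

theorem smul_complexVec (r : ℝ) (p q : R10) :
    complexVec (r • p) (r • q) = (r : ℂ) • complexVec p q := by
  ext k
  simp only [complexVec_apply, PiLp.smul_apply, smul_eq_mul]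
  push_cast
  ring

/-- A point of the quadric is of the form `[p + i q]`, and the pair can be rescaled from any
representative. -/
theorem exists_toQuadric_eq {v : C10} (hv : v ≠ 0) (h0 : ∑ k, v k ^ 2 = 0) :
    ∃ r : ℝ, r ≠ 0 ∧ ∃ W, PosCompl W (r • reVec v) (r • imVec v) ∧
      (W.toQuadric : ℙ ℂ C10) = Projectivization.mk ℂ v hv := by
  have hs := sum_sq_complexVec (reVec v) (imVec v)
  have hn := norm_sq_complexVec (reVec v) (imVec v)
  rw [complexVec_reVec_imVec] at hs hn
  rw [h0] at hs
  have h1 : inner ℝ (reVec v) (reVec v) - inner ℝ (imVec v) (imVec v) = (0 : ℝ) := by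
    have := (congrArg Complex.re hs).symm
    rwa [Complex.add_re, Complex.ofReal_re, Complex.re_ofReal_mul, Complex.I_re, mul_zero,
      add_zero] at this
  have h2 : inner ℝ (reVec v) (imVec v) = (0 : ℝ) := by
    have := (congrArg Complex.im hs).symm
    rw [Complex.add_im, Complex.ofReal_im, Complex.im_ofReal_mul, Complex.I_im, mul_one,
      zero_add, Complex.zero_im] at this
    linarith
  have hpos : 0 < (inner ℝ (reVec v) (reVec v) : ℝ) := by
    have : 0 < ‖v‖ ^ 2 := by positivity
    linarith
  set c : ℝ := inner ℝ (reVec v) (reVec v) with hc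
  -- Real and imaginary parts have the same squared length $c$, so one real factor normalizes both
  -- and does not change the projective point.
  have hr : (Real.sqrt c)⁻¹ ≠ 0 := by positivity
  have hrr : (Real.sqrt c)⁻¹ * ((Real.sqrt c)⁻¹ * c) = 1 := by
    rw [← mul_assoc, ← mul_inv, Real.mul_self_sqrt hpos.le, inv_mul_cancel₀ hpos.ne']
  have ho : Orthonormal ℝ ![(Real.sqrt c)⁻¹ • reVec v, (Real.sqrt c)⁻¹ • imVec v] := by
    rw [orthonormal_pair_iff]
    simp only [real_inner_smul_left, real_inner_smul_right, h2, ← hc,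
      show inner ℝ (imVec v) (imVec v) = c by linarith, hrr]
    simp
  obtain ⟨W, hW⟩ := exists_posCompl_of_orthonormal ho
  refine ⟨_, hr, W, hW, Projectivization.submodule_injective ?_⟩
  rw [hW.submodule_toQuadric, Projectivization.submodule_mk, smul_complexVec,
    complexVec_reVec_imVec]
  exact Submodule.span_singleton_smul_eq (by simpa using hr) v

theorem Gr.toQuadric_bijective : Function.Bijective Gr.toQuadric := by
  refine ⟨fun W W' h => Gr.form_injective ?_, fun z => ?_⟩
  · rw [← Gr.projToForm_toQuadric, h, Gr.projToForm_toQuadric]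
  · obtain ⟨z, hz⟩ := z
    induction z using Projectivization.ind with
    | h v hv =>
      obtain ⟨-, -, W, -, hW⟩ := exists_toQuadric_eq hv
        (hz v (by rw [Projectivization.submodule_mk]; exact Submodule.mem_span_singleton_self v))
      exact ⟨W, Subtype.ext hW⟩

theorem SmoothThrough.of_contDiff {X E F : Type*} [NormedAddCommGroup E] [NormedSpace ℝ E]
    [NormedAddCommGroup F] [NormedSpace ℝ F] {i : X → E} {j : X → F} {g : E → F}
    (hg : ContDiff ℝ ∞ g) (h : ∀ x, g (i x) = j x) : SmoothThrough i j := fun _ =>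
  ⟨Set.univ, isOpen_univ, trivial, g, hg.contDiffOn, fun x' _ => h x'⟩

/-- Both directions factor through the bivector and extend smoothly to the whole ambient spaces, so
no local charts are needed. -/
theorem Gr.isSmoothEmbeddingVia_toQuadric :
    IsSmoothEmbeddingVia Gr.plucker (fun z : Q8 => projOnto z) Gr.toQuadric := by
  refine ⟨Gr.toQuadric_bijective.1,
    .of_contDiff (contDiff_formToProj contDiff_pluckerToForm) fun W => ?_,
    .of_contDiff (contDiff_formToPlucker contDiff_projToForm) fun W => ?_⟩
  · exact W.projOnto_toQuadric.symm
  · simp only [Function.comp_apply, Gr.projToForm_toQuadric, Gr.formToPlucker_form]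

/-! ### Complex structures -/

theorem matAct_add (J : Mat10) (x y : R10) : matAct J (x + y) = matAct J x + matAct J y := by
  ext k; simp [matAct, Matrix.mulVec_add]

theorem matAct_smul (J : Mat10) (r : ℝ) (x : R10) : matAct J (r • x) = r • matAct J x := by
  ext k; simp [matAct, Matrix.mulVec_smul]

theorem matAct_neg (J : Mat10) (x : R10) : matAct J (-x) = -matAct J x := by
  ext k; simp [matAct, Matrix.mulVec_neg]

theorem neg_matAct (J : Mat10) (x : R10) : matAct (-J) x = -matAct J x := by
  ext k; simp [matAct, Matrix.neg_mulVec]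

theorem matAct_one (x : R10) : matAct 1 x = x := by
  ext k; simp [matAct]

theorem matAct_mul (J K : Mat10) (x : R10) : matAct (J * K) x = matAct J (matAct K x) := by
  ext k; simp [matAct, Matrix.mulVec_mulVec]

theorem matAct_stdVec (J : Mat10) (k l : Fin 10) : matAct J (stdVec l) k = J k l := by
  simp [matAct, stdVec]

theorem inner_matAct_right (J : Mat10) (x y : R10) :
    inner ℝ x (matAct J y) = (inner ℝ (matAct J.transpose x) y : ℝ) := by
  simp only [matAct, EuclideanSpace.inner_eq_star_dotProduct, star_trivial]
  rw [dotProduct_comm, Matrix.dotProduct_mulVec, Matrix.mulVec_transpose, dotProduct_comm]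

theorem inner_matAct_matAct {J : Mat10} (hJ : J ∈ Matrix.orthogonalGroup (Fin 10) ℝ) (x y : R10) :
    inner ℝ (matAct J x) (matAct J y) = (inner ℝ x y : ℝ) := by
  rw [inner_matAct_right, ← matAct_mul, (Matrix.mem_orthogonalGroup_iff' _ _).1 hJ, matAct_one]

/-- The orthogonal complex structures. -/
def orthogonalComplexStructures : Set Mat10 :=
  {J | J ∈ Matrix.orthogonalGroup (Fin 10) ℝ ∧ J * J = -1}

theorem matAct_matAct {J : Mat10} (hJ : J * J = -1) (x : R10) : matAct J (matAct J x) = -x := by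
  rw [← matAct_mul, hJ, neg_matAct, matAct_one]

theorem inner_matAct_swap {J : Mat10} (hJ : J ∈ orthogonalComplexStructures) (x y : R10) :
    inner ℝ x (matAct J y) = -(inner ℝ (matAct J x) y : ℝ) := by
  rw [← inner_matAct_matAct hJ.1, matAct_matAct hJ.2, inner_neg_right]

theorem inner_matAct_self {J : Mat10} (hJ : J ∈ orthogonalComplexStructures) (x : R10) :
    inner ℝ x (matAct J x) = (0 : ℝ) := by
  have := inner_matAct_swap hJ x x
  rw [real_inner_comm] at this
  rw [real_inner_comm]
  linarith

theorem orthonormal_matAct {J : Mat10} (hJ : J ∈ orthogonalComplexStructures) {x : R10}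
    (hx : inner ℝ x x = (1 : ℝ)) : Orthonormal ℝ ![x, matAct J x] := by
  rw [orthonormal_pair_iff, inner_matAct_matAct hJ.1]
  exact ⟨hx, hx, inner_matAct_self hJ x⟩

/-- The subspace of all vectors of the form `p + i J p`. -/
noncomputable def complexSubspace (J : Mat10) (hJ : J * J = -1) : Submodule ℂ C10 where
  carrier := {v | matAct J (reVec v) = imVec v}
  add_mem' := by
    rintro v w (hv : _ = _) (hw : _ = _)
    have e1 : reVec (v + w) = reVec v + reVec w := by ext k; simp [reVec]
    have e2 : imVec (v + w) = imVec v + imVec w := by ext k; simp [imVec]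
    change _ = _
    rw [e1, e2, matAct_add, hv, hw]
  zero_mem' := by
    have e1 : reVec 0 = 0 := by ext k; simp [reVec]
    have e2 : imVec 0 = 0 := by ext k; simp [imVec]
    change _ = _
    rw [e1, e2]
    ext k; simp [matAct]
  smul_mem' := by
    rintro c v (hv : _ = _)
    have e1 : reVec (c • v) = c.re • reVec v - c.im • imVec v := by ext k; simp [reVec, imVec]
    have e2 : imVec (c • v) = c.re • imVec v + c.im • reVec v := by ext k; simp [reVec, imVec]
    change _ = _
    rw [e1, e2, sub_eq_add_neg, ← smul_neg, matAct_add, matAct_smul, matAct_smul, matAct_neg, hv,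
      ← hv, matAct_matAct hJ, neg_neg]

theorem mem_complexSubspace {J : Mat10} {hJ : J * J = -1} {v : C10} :
    v ∈ complexSubspace J hJ ↔ matAct J (reVec v) = imVec v := Iff.rfl

theorem reVec_complexVec (p q : R10) : reVec (complexVec p q) = p := by
  ext k; simp [reVec, complexVec_re]

theorem imVec_complexVec (p q : R10) : imVec (complexVec p q) = q := by
  ext k; simp [imVec, complexVec_im]

/-- The real isomorphism `p ↦ p + i J p`. -/
noncomputable def complexSubspaceEquiv (J : Mat10) (hJ : J * J = -1) :
    R10 ≃ₗ[ℝ] complexSubspace J hJ where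
  toFun p := ⟨complexVec p (matAct J p), by
    rw [mem_complexSubspace, reVec_complexVec, imVec_complexVec]⟩
  map_add' p q := by
    ext k
    simp [complexVec_apply, matAct_add]
    ring
  map_smul' r p := by
    ext k
    simp [complexVec_apply, matAct_smul]
    ring
  invFun v := reVec v.1
  left_inv p := reVec_complexVec _ _
  right_inv v := Subtype.ext (by
    simp only
    rw [mem_complexSubspace.1 v.2, complexVec_reVec_imVec])

theorem finrank_complexSubspace (J : Mat10) (hJ : J * J = -1) :
    Module.finrank ℂ (complexSubspace J hJ) = 5 := by
  have h1 := (complexSubspaceEquiv J hJ).finrank_eq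
  have h2 := finrank_real_of_complex (complexSubspace J hJ)
  rw [finrank_euclideanSpace_fin] at h1
  have h3 : Module.finrank ℝ (complexSubspace J hJ) = 10 := h1.symm
  omega

/-- A vector $p+iJp$ satisfies the quadric equation automatically, because $|Jp|=|p|$ and $Jp\perp
p$. After a real rescaling it comes from an orthonormal pair $(p,Jp)$. -/
theorem toQuadric_image_complexLines {J : Mat10} (hJ : J ∈ orthogonalComplexStructures) :
    (fun W : Gr 8 => (W.toQuadric : ℙ ℂ C10)) '' complexLines J =
      projSubspace (complexSubspace J hJ.2) := by
  ext z
  constructor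
  · rintro ⟨W, ⟨p, hp⟩, rfl⟩
    change Projectivization.submodule _ ≤ _
    rw [hp.submodule_toQuadric, Submodule.span_singleton_le_iff_mem, mem_complexSubspace,
      reVec_complexVec, imVec_complexVec]
  · induction z using Projectivization.ind with
    | h v hv =>
      intro hz
      change Projectivization.submodule _ ≤ _ at hz
      rw [Projectivization.submodule_mk, Submodule.span_singleton_le_iff_mem,
        mem_complexSubspace] at hz
      have h0 : ∑ k, v k ^ 2 = 0 := by
        rw [← complexVec_reVec_imVec v, sum_sq_complexVec, ← hz, inner_matAct_matAct hJ.1,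
          inner_matAct_self hJ]
        simp
      obtain ⟨r, -, W, hW, e⟩ := exists_toQuadric_eq hv h0
      refine ⟨W, ⟨r • reVec v, ?_⟩, e⟩
      rwa [matAct_smul, hz]

/-! ### A complex structure is determined by its complex lines -/

theorem exists_posCompl_matAct {J : Mat10} (hJ : J ∈ orthogonalComplexStructures) {x : R10}
    (hx : inner ℝ x x = (1 : ℝ)) : ∃ W, PosCompl W x (matAct J x) :=
  exists_posCompl_of_orthonormal (orthonormal_matAct hJ hx)

theorem ext_of_matAct {J K : Mat10} (h : ∀ x : R10, inner ℝ x x = (1 : ℝ) → matAct J x = matAct K x) :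
    J = K := by
  ext k l
  have := h (stdVec l) (by rw [inner_stdVec, stdVec_apply, if_pos rfl])
  rw [← matAct_stdVec J k l, ← matAct_stdVec K k l, this]

/-- Membership supplies only some basis $(x,Jx)$; the point is that every positive orthonormal basis
of the complement then has this form. Indeed $J=-F$ on the image of $F$, so $p=Fq$ gives $Jp=-Fp=q$.
-/
theorem matAct_form_of_mem_complexLines {J : Mat10} (hJ : J ∈ orthogonalComplexStructures)
    {W : Gr 8} (hW : W ∈ complexLines J) {p q : R10} (h : PosCompl W p q) :
    matAct J p = q := by
  obtain ⟨x, hx⟩ := hW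
  have e := h.form_eq.symm.trans hx.form_eq
  have hq : q = -matAct (wedge x (matAct J x)) p := by
    rw [← e, matAct_wedge_left h.orthonormal, neg_neg]
  have hp : p = matAct (wedge x (matAct J x)) q := by
    rw [← e, matAct_wedge_right h.orthonormal]
  have hx1 := ((orthonormal_pair_iff _ _).1 hx.orthonormal).1
  have key : ∀ y, matAct J (matAct (wedge x (matAct J x)) y) =
      -matAct (wedge x (matAct J x)) (matAct (wedge x (matAct J x)) y) := by
    intro y
    have h1 := inner_matAct_self hJ x
    have h2 : inner ℝ (matAct J x) (matAct J x) = (1 : ℝ) := by rw [inner_matAct_matAct hJ.1, hx1]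
    have h3 : inner ℝ (matAct J x) x = (0 : ℝ) := by rw [real_inner_comm, h1]
    rw [matAct_wedge x _ y]
    rw [matAct_wedge]
    simp only [inner_sub_right, real_inner_smul_right, hx1, h1, h2, h3]
    rw [sub_eq_add_neg, ← neg_smul, matAct_add, matAct_smul, matAct_smul, matAct_matAct hJ.2]
    module
  rw [hp, key, ← hp, ← hq]

theorem complexLines_injOn : Set.InjOn complexLines orthogonalComplexStructures := by
  intro J hJ K hK e
  refine ext_of_matAct fun x hx => ?_
  obtain ⟨W, hW⟩ := exists_posCompl_matAct hJ hx
  have : W ∈ complexLines K := e ▸ ⟨x, hW⟩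
  exact (matAct_form_of_mem_complexLines hK this hW).symm

theorem mem_complexLines_iff {J : Mat10} (hJ : J ∈ orthogonalComplexStructures) {W : Gr 8}
    {p q : R10} (h : PosCompl W p q) : W ∈ complexLines J ↔ matAct J p = q :=
  ⟨fun hW => matAct_form_of_mem_complexLines hJ hW h, fun e => ⟨p, e ▸ h⟩⟩

/-! ### Orientations of complex structures -/

/-- Conjugation by a unipotent block matrix with off-diagonal block $i$ makes the matrix block
triangular, with diagonal blocks $A\pm iB$. -/
theorem det_fromBlocks_skew {n : Type*} [Fintype n] [DecidableEq n] (A B : Matrix n n ℂ) :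
    (Matrix.fromBlocks A (-B) B A).det =
      (A + Complex.I • B).det * (A - Complex.I • B).det := by
  have e : Matrix.fromBlocks 1 (Complex.I • 1) 0 1 * Matrix.fromBlocks A (-B) B A *
      Matrix.fromBlocks 1 (-Complex.I • 1) 0 1 =
      Matrix.fromBlocks (A + Complex.I • B) 0 B (A - Complex.I • B) := by
    rw [Matrix.fromBlocks_multiply, Matrix.fromBlocks_multiply]
    congr 1
    · simp
    · ext i j
      simp
      linear_combination -(B i j) * Complex.I_sq
    · simp
    · ext i j
      simp
      ring
  have e2 := congrArg Matrix.det e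
  rw [Matrix.det_mul, Matrix.det_mul, Matrix.det_fromBlocks_zero₁₂,
    Matrix.det_fromBlocks_zero₂₁, Matrix.det_fromBlocks_zero₂₁] at e2
  simpa using e2

theorem det_realify (U : Matrix (Fin 5) (Fin 5) ℂ) :
    (realify U).det = Complex.normSq U.det := by
  have e1 : U.map (fun z => (z.re : ℂ)) + Complex.I • U.map (fun z => (z.im : ℂ)) = U := by
    ext i j
    simp [mul_comm Complex.I, Complex.re_add_im]
  have e2 : U.map (fun z => (z.re : ℂ)) - Complex.I • U.map (fun z => (z.im : ℂ)) =
      U.map (starRingEnd ℂ) := by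
    ext i j
    apply Complex.ext <;> simp
  apply Complex.ofReal_injective
  rw [realify, Matrix.det_reindex_self]
  have e3 : Complex.ofRealHom.mapMatrix (Matrix.fromBlocks (U.map Complex.re)
      (-U.map Complex.im) (U.map Complex.im) (U.map Complex.re)) =
      Matrix.fromBlocks (U.map (fun z => (z.re : ℂ))) (-U.map (fun z => (z.im : ℂ)))
        (U.map (fun z => (z.im : ℂ))) (U.map (fun z => (z.re : ℂ))) := by
    ext (i | i) (j | j) <;> simp
  refine (RingHom.map_det Complex.ofRealHom _).trans ?_
  rw [e3, det_fromBlocks_skew, e1, e2, ← Complex.mul_conj]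
  congr 1
  exact (RingHom.map_det (starRingEnd ℂ) U).symm

theorem realify_apply (U : Matrix (Fin 5) (Fin 5) ℂ) (i j : Fin 5) :
    realify U (Fin.castAdd 5 i) (Fin.castAdd 5 j) = (U i j).re ∧
    realify U (Fin.castAdd 5 i) (Fin.natAdd 5 j) = -(U i j).im ∧
    realify U (Fin.natAdd 5 i) (Fin.castAdd 5 j) = (U i j).im ∧
    realify U (Fin.natAdd 5 i) (Fin.natAdd 5 j) = (U i j).re := by
  simp only [realify, Matrix.reindex_apply, Matrix.submatrix_apply,
    finSumFinEquiv_symm_apply_castAdd, finSumFinEquiv_symm_apply_natAdd]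
  simp

theorem forall_fin_ten {P : Fin 10 → Prop} :
    (∀ i, P i) ↔ (∀ i : Fin 5, P (Fin.castAdd 5 i)) ∧ ∀ i : Fin 5, P (Fin.natAdd 5 i) :=
  ⟨fun h => ⟨fun _ => h _, fun _ => h _⟩, fun h i =>
    Fin.addCases (m := 5) (n := 5) (motive := P) h.1 h.2 i⟩

theorem sum_fin_ten {M : Type*} [AddCommMonoid M] (f : Fin 10 → M) :
    ∑ i, f i = ∑ i : Fin 5, f (Fin.castAdd 5 i) + ∑ i : Fin 5, f (Fin.natAdd 5 i) :=
  Fin.sum_univ_add (a := 5) (b := 5) f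

theorem matAct_J0 (x : R10) (i : Fin 5) :
    matAct J0 x (Fin.castAdd 5 i) = -x (Fin.natAdd 5 i) ∧
    matAct J0 x (Fin.natAdd 5 i) = x (Fin.castAdd 5 i) := by
  simp only [matAct, Matrix.mulVec, dotProduct, J0]
  rw [sum_fin_ten, sum_fin_ten]
  simp only [realify_apply]
  simp [Matrix.diagonal_apply, apply_ite Complex.re, apply_ite Complex.im]

theorem stdVec_apply_split (i j : Fin 5) :
    stdVec (Fin.castAdd 5 i) (Fin.castAdd 5 j) = (if j = i then 1 else 0) ∧
    stdVec (Fin.castAdd 5 i) (Fin.natAdd 5 j) = 0 ∧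
    stdVec (Fin.natAdd 5 i) (Fin.castAdd 5 j) = 0 ∧
    stdVec (Fin.natAdd 5 i) (Fin.natAdd 5 j) = (if j = i then 1 else 0) := by
  have hne : Fin.natAdd 5 j ≠ (Fin.castAdd 5 i : Fin 10) := by
    intro h; simp [Fin.ext_iff] at h; omega
  have hne' : Fin.castAdd 5 j ≠ (Fin.natAdd 5 i : Fin 10) := by
    intro h; simp [Fin.ext_iff] at h; omega
  have h1 : Fin.castAdd 5 j = (Fin.castAdd 5 i : Fin 10) ↔ j = i := by simp [Fin.ext_iff]
  have h2 : Fin.natAdd 5 j = (Fin.natAdd 5 i : Fin 10) ↔ j = i := by simp [Fin.ext_iff]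
  simp only [stdVec_apply, hne, hne', h1, h2, if_false, and_self]

theorem matAct_J0_stdVec (i : Fin 5) :
    matAct J0 (stdVec (Fin.castAdd 5 i)) = stdVec (Fin.natAdd 5 i) ∧
    matAct J0 (stdVec (Fin.natAdd 5 i)) = -stdVec (Fin.castAdd 5 i) := by
  constructor <;>
  · ext k
    revert k
    rw [forall_fin_ten]
    simp only [matAct_J0, PiLp.neg_apply, stdVec_apply_split, neg_zero, implies_true, and_self]

/-- The vectors `v` followed by the vectors `J v`. -/
noncomputable def complexBasis (J : Mat10) (v : Fin 5 → R10) : Fin 10 → R10 :=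
  Fin.append (m := 5) (n := 5) v (matAct J ∘ v)

theorem complexBasis_castAdd (J : Mat10) (v : Fin 5 → R10) (i : Fin 5) :
    complexBasis J v (Fin.castAdd 5 i) = v i := Fin.append_left (m := 5) (n := 5) _ _ _

theorem complexBasis_natAdd (J : Mat10) (v : Fin 5 → R10) (i : Fin 5) :
    complexBasis J v (Fin.natAdd 5 i) = matAct J (v i) := Fin.append_right (m := 5) (n := 5) _ _ _

/-- The permutation that interleaves the first five elements with the last five. -/
def interleave : Equiv.Perm (Fin 10) where
  toFun := ![0, 5, 1, 6, 2, 7, 3, 8, 4, 9]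
  invFun := ![0, 2, 4, 6, 8, 1, 3, 5, 7, 9]
  left_inv := by decide
  right_inv := by decide

/-- The shuffle has $4+3+2+1=10$ inversions, so the orders $v_0,Jv_0,v_1,\dots$ and
$v_0,\dots,v_4,Jv_0,\dots$ define the same orientation. -/
theorem sign_interleave : Equiv.Perm.sign interleave = 1 := by decide +kernel

theorem det_complexBasisMatrix (J : Mat10) (v : Fin 5 → R10) :
    (complexBasisMatrix J v).det = (rowMatrix (complexBasis J v)).det := by
  have e : complexBasisMatrix J v = (rowMatrix (complexBasis J v)).submatrix interleave id := by
    ext a b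
    fin_cases a <;> rfl
  rw [e, Matrix.det_permute, sign_interleave]
  simp

/-- Vectors appear as rows here, which transposes the realification convention; hence the complex
entries are conjugated. -/
theorem rowMatrix_complexBasis_J0 (v : Fin 5 → R10) :
    rowMatrix (complexBasis J0 v) = realify (Matrix.of fun i j =>
      ⟨v i (Fin.castAdd 5 j), -v i (Fin.natAdd 5 j)⟩) := by
  ext i j
  revert i j
  simp only [forall_fin_ten, realify_apply]
  simp only [rowMatrix, Matrix.of_apply, complexBasis_castAdd, complexBasis_natAdd, matAct_J0,
    neg_neg, implies_true, and_self]

theorem det_complexBasis_J0_nonneg (v : Fin 5 → R10) :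
    0 ≤ (rowMatrix (complexBasis J0 v)).det := by
  rw [rowMatrix_complexBasis_J0, det_realify]
  exact Complex.normSq_nonneg _

theorem det_complexBasis_J0_stdVec :
    (rowMatrix (complexBasis J0 fun i => stdVec (Fin.castAdd 5 i))).det = 1 := by
  have : (Matrix.of fun i j : Fin 5 => (⟨stdVec (Fin.castAdd 5 i) (Fin.castAdd 5 j),
      -stdVec (Fin.castAdd 5 i) (Fin.natAdd 5 j)⟩ : ℂ)) = 1 := by
    ext i j
    simp only [Matrix.of_apply, stdVec_apply_split, Matrix.one_apply, eq_comm (a := i)]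
    split_ifs <;> apply Complex.ext <;> simp
  rw [rowMatrix_complexBasis_J0, this, realify_one, Matrix.det_one]

theorem rowMatrix_complexBasis_of_comm {J K g : Mat10} (h : J * g = g * K) (v : Fin 5 → R10) :
    rowMatrix (complexBasis J fun i => matAct g (v i)) =
      rowMatrix (complexBasis K v) * g.transpose := by
  have key : ∀ i, complexBasis J (fun i => matAct g (v i)) i = matAct g (complexBasis K v i) := by
    rw [forall_fin_ten]
    simp only [complexBasis_castAdd, complexBasis_natAdd, ← matAct_mul, h, implies_true, and_self]
  ext i j
  change complexBasis J (fun i => matAct g (v i)) i j = _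
  rw [key]
  simp only [rowMatrix, Matrix.of_apply, matAct, Matrix.mulVec, dotProduct, Matrix.mul_apply,
    Matrix.transpose_apply]
  exact Finset.sum_congr rfl fun _ _ => mul_comm _ _

/-- All bases adapted to $J$ have the orientation given by the sign of $\det g$: pulling back by $g$
reduces to $J_0$, where the determinant is a squared modulus. The factor $c$ vanishes when the
vectors are dependent. -/
theorem det_complexBasis_of_comm {J g : Mat10} (hg : g ∈ Matrix.orthogonalGroup (Fin 10) ℝ)
    (h : J * g = g * J0) (v : Fin 5 → R10) :
    ∃ c, 0 ≤ c ∧ (rowMatrix (complexBasis J v)).det = c * g.det := by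
  refine ⟨_, det_complexBasis_J0_nonneg fun i => matAct g.transpose (v i), ?_⟩
  have e := rowMatrix_complexBasis_of_comm h fun i => matAct g.transpose (v i)
  simp only [← matAct_mul, (Matrix.mem_orthogonalGroup_iff _ _).1 hg, matAct_one] at e
  rw [e, Matrix.det_mul, Matrix.det_transpose]

/-! ### Unitary frames -/

theorem inner_complexVec (p q p' q' : R10) :
    inner ℂ (complexVec p q) (complexVec p' q') =
      ((inner ℝ p p' + inner ℝ q q' : ℝ) : ℂ) + ((inner ℝ p q' - inner ℝ q p' : ℝ) : ℂ) *
        Complex.I := by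
  simp only [inner_eq_sum, ← Finset.sum_sub_distrib, ← Finset.sum_add_distrib, Complex.ofReal_sum,
    Finset.sum_mul]
  rw [PiLp.inner_apply]
  refine Finset.sum_congr rfl fun k _ => ?_
  simp only [RCLike.inner_apply, complexVec_apply, map_add, map_mul, Complex.conj_ofReal,
    Complex.conj_I]
  push_cast
  linear_combination (-(q k : ℂ) * q' k) * Complex.I_sq

theorem exists_unitary_frame {J : Mat10} (hJ : J ∈ orthogonalComplexStructures) :
    ∃ v : Fin 5 → R10, ∀ i j, inner ℝ (v i) (v j) = (if i = j then 1 else 0 : ℝ) ∧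
      inner ℝ (v i) (matAct J (v j)) = (0 : ℝ) := by
  let b := (stdOrthonormalBasis ℂ (complexSubspace J hJ.2)).reindex
    (finCongr (finrank_complexSubspace J hJ.2))
  -- For $p+iJp$ and $p'+iJp'$ the Hermitian product has real part $2\langle p,p'\rangle$ and
  -- imaginary part $2\langle p,Jp'\rangle$; $\sqrt2$ restores unit length.
  refine ⟨fun i => Real.sqrt 2 • reVec (b i).1, fun i j => ?_⟩
  have hb := b.inner_eq_ite i j
  rw [Submodule.coe_inner, ← complexVec_reVec_imVec (b i).1, ← complexVec_reVec_imVec (b j).1,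
    ← mem_complexSubspace.1 (b i).2, ← mem_complexSubspace.1 (b j).2, inner_complexVec,
    inner_matAct_matAct hJ.1] at hb
  have h2 : Real.sqrt 2 * Real.sqrt 2 = 2 := Real.mul_self_sqrt (by norm_num)
  have hsw := inner_matAct_swap hJ (reVec (b i).1) (reVec (b j).1)
  have hre := congrArg Complex.re hb
  have him := congrArg Complex.im hb
  rw [Complex.add_re, Complex.ofReal_re, Complex.re_ofReal_mul, Complex.I_re] at hre
  rw [Complex.add_im, Complex.ofReal_im, Complex.im_ofReal_mul, Complex.I_im] at him
  simp only [matAct_smul, real_inner_smul_left, real_inner_smul_right, ← mul_assoc, h2]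
  constructor
  · by_cases hij : i = j
    · simp only [hij, if_true, Complex.one_re] at hre ⊢
      linarith
    · simp only [hij, if_false, Complex.zero_re] at hre ⊢
      linarith
  · have : (if i = j then (1 : ℂ) else 0).im = 0 := by split_ifs <;> simp
    rw [this] at him
    linarith

theorem orthonormal_complexBasis {J : Mat10} (hJ : J ∈ orthogonalComplexStructures)
    {v : Fin 5 → R10} (hv : ∀ i j, inner ℝ (v i) (v j) = (if i = j then 1 else 0 : ℝ) ∧
      inner ℝ (v i) (matAct J (v j)) = (0 : ℝ)) : Orthonormal ℝ (complexBasis J v) := by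
  rw [orthonormal_iff_ite, forall_fin_ten]
  have hne : ∀ i j : Fin 5, Fin.natAdd 5 j ≠ (Fin.castAdd 5 i : Fin 10) := by
    intro i j h; simp [Fin.ext_iff] at h; omega
  constructor
  · intro i
    rw [forall_fin_ten]
    simp only [complexBasis_castAdd, complexBasis_natAdd, (hv _ _).1, (hv _ _).2, (hne _ _).symm,
      if_false, implies_true, and_true]
    simp [Fin.ext_iff]
  · intro i
    rw [forall_fin_ten]
    simp only [complexBasis_castAdd, complexBasis_natAdd, (hv _ _).1, real_inner_comm,
      inner_matAct_matAct hJ.1, (hv _ _).2, hne, if_false, implies_true, true_and]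
    simp [Fin.ext_iff]

/-- Take the matrix whose columns are a unitary frame $v$ followed by $Jv$. It carries the standard
complex basis to the one of $J$, but its determinant may be $-1$. -/
theorem exists_orthogonal_conj {J : Mat10} (hJ : J ∈ orthogonalComplexStructures) :
    ∃ g ∈ Matrix.orthogonalGroup (Fin 10) ℝ, J * g = g * J0 := by
  obtain ⟨v, hv⟩ := exists_unitary_frame hJ
  have ho := orthonormal_complexBasis hJ hv
  have hcol : ∀ i, matAct (rowMatrix (complexBasis J v)).transpose (stdVec i) =
      complexBasis J v i := by
    intro i
    ext k
    rw [matAct_stdVec]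
    rfl
  refine ⟨(rowMatrix (complexBasis J v)).transpose, ?_, ?_⟩
  · rw [Matrix.mem_orthogonalGroup_iff', Matrix.transpose_transpose, rowMatrix_mul_transpose]
    exact (orthonormal_iff_gramOf _).1 ho
  · have key : ∀ i, matAct J (complexBasis J v i) =
        matAct (rowMatrix (complexBasis J v)).transpose (matAct J0 (stdVec i)) := by
      rw [forall_fin_ten]
      simp only [matAct_J0_stdVec, matAct_neg, hcol, complexBasis_castAdd, complexBasis_natAdd,
        matAct_matAct hJ.2, implies_true, and_self]
    ext k l
    rw [← matAct_stdVec (J * _) k l, ← matAct_stdVec (_ * J0) k l, matAct_mul, matAct_mul, hcol,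
      key]

/-! ### The space of positive complex structures -/

theorem SO10_transpose_mul (g : SO10) : g.1.transpose * g.1 = 1 :=
  (Matrix.mem_orthogonalGroup_iff' _ _).1 g.2.1

theorem SO10_mul_transpose (g : SO10) : g.1 * g.1.transpose = 1 :=
  (Matrix.mem_orthogonalGroup_iff _ _).1 g.2.1

theorem SO10_coe_inv (g : SO10) : (g⁻¹).1 = g.1.transpose :=
  left_inv_eq_right_inv (congrArg Subtype.val (inv_mul_cancel g) : (g⁻¹).1 * g.1 = 1)
    (SO10_mul_transpose g)

theorem J0_sq : J0 * J0 = -1 := by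
  refine ext_of_matAct fun x _ => ?_
  rw [matAct_mul, neg_matAct, matAct_one]
  ext k
  revert k
  rw [forall_fin_ten]
  simp only [matAct_J0, PiLp.neg_apply, implies_true, and_self]

theorem realify_star (U : Matrix (Fin 5) (Fin 5) ℂ) : realify (star U) = (realify U).transpose := by
  ext i j
  revert i j
  simp only [forall_fin_ten, Matrix.transpose_apply, realify_apply]
  simp [Matrix.star_apply]

theorem realify_injective : Function.Injective realify := by
  intro U V h
  ext i j
  have h1 := congrFun (congrFun h (Fin.castAdd 5 i)) (Fin.castAdd 5 j)
  have h2 := congrFun (congrFun h (Fin.natAdd 5 i)) (Fin.castAdd 5 j)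
  rw [(realify_apply U i j).1, (realify_apply V i j).1] at h1
  rw [(realify_apply U i j).2.2.1, (realify_apply V i j).2.2.1] at h2
  exact Complex.ext h1 h2

theorem J0_mem : J0 ∈ orthogonalComplexStructures := by
  refine ⟨?_, J0_sq⟩
  have h : J0.transpose = -J0 := by
    rw [J0, ← realify_star]
    ext i j
    revert i j
    simp only [forall_fin_ten, Matrix.neg_apply, realify_apply]
    simp [Matrix.star_apply, Matrix.diagonal_apply, apply_ite Complex.re, apply_ite Complex.im,
      eq_comm]
  rw [Matrix.mem_orthogonalGroup_iff, h, mul_neg, J0_sq, neg_neg]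

theorem conjJ0_mem (g : SO10) : conjJ0 g ∈ orthogonalComplexStructures := by
  have h1 := SO10_transpose_mul g
  constructor
  · have h2 : J0 * J0.transpose = 1 := (Matrix.mem_orthogonalGroup_iff _ _).1 J0_mem.1
    rw [Matrix.mem_orthogonalGroup_iff, conjJ0, SO10_coe_inv g]
    calc g.1 * J0 * g.1.transpose * (g.1 * J0 * g.1.transpose).transpose
        = g.1 * J0 * (g.1.transpose * g.1) * J0.transpose * g.1.transpose := by
          simp only [Matrix.transpose_mul, Matrix.transpose_transpose, Matrix.mul_assoc]
      _ = 1 := by rw [h1, Matrix.mul_one, Matrix.mul_assoc g.1, h2, Matrix.mul_one, SO10_mul_transpose g]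
  · rw [conjJ0, SO10_coe_inv g]
    calc g.1 * J0 * g.1.transpose * (g.1 * J0 * g.1.transpose)
        = g.1 * J0 * (g.1.transpose * g.1) * J0 * g.1.transpose := by
          simp only [Matrix.mul_assoc]
      _ = -1 := by
        rw [h1, Matrix.mul_one, Matrix.mul_assoc g.1, J0_sq, Matrix.mul_neg, Matrix.mul_one,
          Matrix.neg_mul, SO10_mul_transpose g]

theorem conjJ0_mul (g : SO10) : conjJ0 g * g.1 = g.1 * J0 := by
  rw [conjJ0, SO10_coe_inv g, Matrix.mul_assoc, SO10_transpose_mul g, Matrix.mul_one]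

theorem JPos_eq : JPos = Set.range conjJ0 := by
  ext J
  constructor
  · rintro ⟨h1, h2, v, hv⟩
    obtain ⟨g, hg, e⟩ := exists_orthogonal_conj ⟨h1, h2⟩
    obtain ⟨c, hc, hd⟩ := det_complexBasis_of_comm hg e v
    rw [det_complexBasisMatrix, hd] at hv
    have hgpos : 0 < g.det := pos_of_mul_pos_right hv hc
    have hgT : g * g.transpose = 1 := (Matrix.mem_orthogonalGroup_iff _ _).1 hg
    have hdet : g.det = 1 := by
      have := congrArg Matrix.det hgT
      rw [Matrix.det_mul, Matrix.det_transpose, Matrix.det_one] at this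
      nlinarith
    let g' : SO10 := ⟨g, hg, hdet⟩
    refine ⟨g', ?_⟩
    rw [conjJ0, SO10_coe_inv g']
    change g * J0 * g.transpose = J
    rw [← e, Matrix.mul_assoc, hgT, Matrix.mul_one]
  · rintro ⟨g, rfl⟩
    refine ⟨(conjJ0_mem g).1, (conjJ0_mem g).2, fun i => matAct g.1 (stdVec (Fin.castAdd 5 i)), ?_⟩
    rw [det_complexBasisMatrix, rowMatrix_complexBasis_of_comm (conjJ0_mul g), Matrix.det_mul,
      det_complexBasis_J0_stdVec, Matrix.det_transpose, show g.1.det = 1 from g.2.2]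
    norm_num

theorem neg_mem_orthogonalComplexStructures {J : Mat10} (h : J ∈ orthogonalComplexStructures) :
    -J ∈ orthogonalComplexStructures := by
  obtain ⟨h1, h2⟩ := h
  refine ⟨?_, by rw [neg_mul_neg, h2]⟩
  rw [Matrix.mem_orthogonalGroup_iff] at h1 ⊢
  rw [Matrix.transpose_neg, neg_mul_neg, h1]

/-- Five rows change sign; the oddness of the complex dimension is what makes $-J$ induce the other
orientation. -/
theorem det_complexBasisMatrix_neg (J : Mat10) (v : Fin 5 → R10) :
    (complexBasisMatrix (-J) v).det = -(complexBasisMatrix J v).det := by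
  have e : complexBasisMatrix (-J) v = Matrix.diagonal ![1, -1, 1, -1, 1, -1, 1, -1, 1, -1] *
      complexBasisMatrix J v := by
    ext a b
    rw [Matrix.diagonal_mul]
    fin_cases a <;> simp [complexBasisMatrix, neg_matAct]
  rw [e, Matrix.det_mul, Matrix.det_diagonal]
  simp [Fin.prod_univ_succ]

theorem mem_JNeg_iff {J : Mat10} : J ∈ JNeg ↔ -J ∈ JPos := by
  constructor
  · rintro ⟨h1, h2, v, hv⟩
    have h := neg_mem_orthogonalComplexStructures ⟨h1, h2⟩
    exact ⟨h.1, h.2, v, by rw [det_complexBasisMatrix_neg]; linarith⟩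
  · rintro ⟨h1, h2, v, hv⟩
    have h := neg_mem_orthogonalComplexStructures ⟨h1, h2⟩
    rw [neg_neg] at h
    rw [det_complexBasisMatrix_neg] at hv
    exact ⟨h.1, h.2, v, by linarith⟩

theorem JPos_subset : JPos ⊆ orthogonalComplexStructures := fun _ h => ⟨h.1, h.2.1⟩

theorem JNeg_subset : JNeg ⊆ orthogonalComplexStructures := fun _ h => ⟨h.1, h.2.1⟩

theorem disjoint_JPos_JNeg : Disjoint JPos JNeg := by
  rw [Set.disjoint_left]
  rintro J h ⟨-, -, v, hv⟩
  rw [JPos_eq] at h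
  obtain ⟨g, rfl⟩ := h
  obtain ⟨c, hc, hd⟩ := det_complexBasis_of_comm g.2.1 (conjJ0_mul g) v
  rw [det_complexBasisMatrix, hd, show g.1.det = 1 from g.2.2] at hv
  linarith

/-! ### The quotient `SO(10)/U(5)` -/

theorem realify_comm_J0 (U : Matrix (Fin 5) (Fin 5) ℂ) : realify U * J0 = J0 * realify U := by
  rw [J0, ← realify_mul, ← realify_mul]
  congr 1
  ext i j
  simp [mul_comm]

theorem exists_realify_of_comm_J0 {M : Mat10} (h : M * J0 = J0 * M) : ∃ U, realify U = M := by
  refine ⟨Matrix.of fun i j => ⟨M (Fin.castAdd 5 i) (Fin.castAdd 5 j),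
    M (Fin.natAdd 5 i) (Fin.castAdd 5 j)⟩, ?_⟩
  -- The last five columns are determined by the first five: $Me_{5+j}=MJ_0e_j=J_0Me_j$.
  have key : ∀ (k : Fin 10) (j : Fin 5), M k (Fin.natAdd 5 j) =
      matAct J0 (matAct M (stdVec (Fin.castAdd 5 j))) k := fun k j => by
    rw [← matAct_mul, ← h, matAct_mul, (matAct_J0_stdVec j).1, matAct_stdVec]
  ext i j
  revert i j
  simp only [forall_fin_ten, realify_apply]
  refine ⟨fun i => ⟨fun j => rfl, fun j => ?_⟩, fun i => ⟨fun j => rfl, fun j => ?_⟩⟩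
  · rw [key, (matAct_J0 _ i).1, matAct_stdVec]
    rfl
  · rw [key, (matAct_J0 _ i).2, matAct_stdVec]
    rfl

/-- Identifies $\mathrm U(5)$ as the stabilizer of $J_0$ under conjugation, which makes
`quotientConj` well defined and injective. -/
theorem mem_U5_iff {g : SO10} : g ∈ U5 ↔ g.1 * J0 = J0 * g.1 := by
  constructor
  · rintro ⟨U, -, h⟩
    rw [← h, realify_comm_J0]
  · intro h
    obtain ⟨U, hU⟩ := exists_realify_of_comm_J0 h
    refine ⟨U, ?_, hU⟩
    rw [Matrix.mem_unitaryGroup_iff]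
    apply realify_injective
    rw [realify_mul, realify_star, realify_one, hU, SO10_mul_transpose g]

theorem conjJ0_eq_iff {g h : SO10} : conjJ0 g = conjJ0 h ↔ g⁻¹ * h ∈ U5 := by
  rw [mem_U5_iff]
  have e : (g⁻¹ * h).1 = g.1.transpose * h.1 := by rw [← SO10_coe_inv g]; rfl
  rw [e, conjJ0, conjJ0, SO10_coe_inv g, SO10_coe_inv h]
  constructor
  · intro H
    calc g.1.transpose * h.1 * J0 = g.1.transpose * (h.1 * J0 * h.1.transpose) * h.1 := by
          simp only [Matrix.mul_assoc, SO10_transpose_mul h, Matrix.mul_one]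
      _ = (g.1.transpose * g.1) * J0 * g.1.transpose * h.1 := by
          rw [← H]; simp only [Matrix.mul_assoc]
      _ = J0 * (g.1.transpose * h.1) := by
          rw [SO10_transpose_mul g, Matrix.one_mul, Matrix.mul_assoc]
  · intro H
    calc g.1 * J0 * g.1.transpose = g.1 * (J0 * (g.1.transpose * h.1)) * h.1.transpose := by
          simp only [Matrix.mul_assoc, SO10_mul_transpose h, Matrix.mul_one]
      _ = (g.1 * g.1.transpose) * h.1 * J0 * h.1.transpose := by
          rw [← H]; simp only [Matrix.mul_assoc]
      _ = h.1 * J0 * h.1.transpose := by rw [SO10_mul_transpose g, Matrix.one_mul]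

theorem sum_sq_row_of_orthogonal {g : Mat10} (hg : g * g.transpose = 1) (i : Fin 10) :
    ∑ j, g i j ^ 2 = 1 := by
  have := congrFun (congrFun hg i) i
  simpa [Matrix.mul_apply, sq] using this

theorem isCompact_setOf_special_orthogonal :
    IsCompact {g : Mat10 | g * g.transpose = 1 ∧ g.det = 1} := by
  have hK : IsCompact (Set.pi Set.univ fun _ : Fin 10 => Set.pi Set.univ fun _ : Fin 10 =>
      Set.Icc (-1 : ℝ) 1) := isCompact_univ_pi fun _ => isCompact_univ_pi fun _ => isCompact_Icc
  refine IsCompact.of_isClosed_subset (X := Mat10) hK ?_ ?_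
  · exact (isClosed_eq (by fun_prop) continuous_const).inter
      (isClosed_singleton.preimage (Continuous.matrix_det continuous_id))
  · intro g hg i _ j _
    have h1 := sum_sq_row_of_orthogonal hg.1 i
    have h2 : g i j ^ 2 ≤ 1 := by
      rw [← h1]
      exact Finset.single_le_sum (f := fun j => g i j ^ 2) (fun _ _ => sq_nonneg _)
        (Finset.mem_univ j)
    exact abs_le.1 ((sq_le_one_iff_abs_le_one _).1 h2)

theorem mem_SO10_iff {g : Mat10} : g ∈ Matrix.specialOrthogonalGroup (Fin 10) ℝ ↔
    g * g.transpose = 1 ∧ g.det = 1 := by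
  rw [Matrix.mem_specialOrthogonalGroup_iff, Matrix.mem_orthogonalGroup_iff]

instance : CompactSpace SO10 := by
  have h : {g : Mat10 | g ∈ Matrix.specialOrthogonalGroup (Fin 10) ℝ} =
      {g : Mat10 | g * g.transpose = 1 ∧ g.det = 1} := Set.ext fun _ => mem_SO10_iff
  have h2 := isCompact_setOf_special_orthogonal
  rw [← h] at h2
  exact isCompact_iff_compactSpace.1 h2

theorem continuous_conjJ0 : Continuous conjJ0 := by
  have : conjJ0 = fun g : SO10 => g.1 * J0 * g.1.transpose := by
    funext g
    rw [conjJ0, SO10_coe_inv g]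
  rw [this]
  fun_prop

/-- The map `g U(5) ↦ g J₀ g⁻¹`. -/
noncomputable def quotientConj : SO10 ⧸ U5 → Mat10 :=
  Quotient.lift conjJ0 fun _ _ h => conjJ0_eq_iff.2 (QuotientGroup.leftRel_apply.1 h)

theorem quotientConj_mk (g : SO10) : quotientConj (QuotientGroup.mk g) = conjJ0 g := rfl

theorem continuous_quotientConj : Continuous quotientConj :=
  continuous_conjJ0.quotient_lift _

theorem quotientConj_injective : Function.Injective quotientConj := by
  intro a b
  refine QuotientGroup.induction_on a fun g => QuotientGroup.induction_on b fun h e => ?_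
  exact QuotientGroup.eq.2 (conjJ0_eq_iff.1 e)

theorem isEmbedding_quotientConj : Topology.IsEmbedding quotientConj :=
  (continuous_quotientConj.isClosedEmbedding quotientConj_injective).isEmbedding

theorem range_quotientConj : Set.range quotientConj = JPos := by
  rw [JPos_eq]
  exact QuotientGroup.mk_surjective.range_comp quotientConj |>.symm

theorem range_neg_quotientConj : Set.range (fun a => -quotientConj a) = JNeg := by
  ext J
  rw [mem_JNeg_iff, ← range_quotientConj]
  constructor
  · rintro ⟨a, rfl⟩
    exact ⟨a, (neg_neg _).symm⟩
  · rintro ⟨a, ha⟩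
    exact ⟨a, by simp only [ha, neg_neg]⟩

/-! ### The Vietoris topology -/

/-- For the condition of lying inside an open set, compactness of $T$ enters through the tube lemma;
for the condition of meeting an open set, the preimage is a union of open sets. -/
theorem vietorisContinuous_image {X T Y : Type*} [TopologicalSpace X] [TopologicalSpace T]
    [TopologicalSpace Y] [CompactSpace T] {F : X × T → Y} (hF : Continuous F) :
    VietorisContinuous fun x => Set.range fun t => F (x, t) := by
  refine continuous_generateFrom_iff.2 ?_
  rintro _ (⟨U, hU, rfl⟩ | ⟨U, hU, rfl⟩)
  · rw [isOpen_iff_mem_nhds]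
    intro x hx
    have hsub : ({x} : Set X) ×ˢ (Set.univ : Set T) ⊆ F ⁻¹' U := by
      rintro ⟨x', t⟩ ⟨rfl, -⟩
      exact hx ⟨t, rfl⟩
    obtain ⟨V, V', hV, -, hxV, hV', h⟩ := generalized_tube_lemma isCompact_singleton isCompact_univ
      (hU.preimage hF) hsub
    refine Filter.mem_of_superset (hV.mem_nhds (hxV rfl)) ?_
    rintro x' hx' _ ⟨t, rfl⟩
    exact h ⟨hx', hV' trivial⟩
  · have : (fun x => Set.range fun t => F (x, t)) ⁻¹' {s | (s ∩ U).Nonempty} =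
        ⋃ t, (fun x => F (x, t)) ⁻¹' U := by
      ext x
      simp only [Set.mem_preimage, Set.mem_iUnion]
      constructor
      · rintro ⟨_, ⟨t, rfl⟩, ht⟩
        exact ⟨t, ht⟩
      · rintro ⟨t, ht⟩
        exact ⟨_, ⟨t, rfl⟩, ht⟩
    rw [this]
    exact isOpen_iUnion fun t => hU.preimage (by fun_prop)

/-- The Vietoris topology on all subsets need not be Hausdorff, but on compact subsets of a
Hausdorff space it is. The map therefore goes through `Compacts`, where the compact-to-Hausdorff
argument applies. -/
theorem VietorisContinuous.embedding {X Y : Type*} [TopologicalSpace X] [TopologicalSpace Y]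
    [CompactSpace X] [T2Space Y] {f : X → Set Y} (hf : VietorisContinuous f)
    (hinj : Function.Injective f) (hc : ∀ x, IsCompact (f x)) : VietorisEmbedding f := by
  let := TopologicalSpace.vietoris Y
  let f' : X → TopologicalSpace.Compacts Y := fun x => ⟨f x, hc x⟩
  have hemb := TopologicalSpace.Compacts.isEmbedding_coe (α := Y)
  have hf' : Continuous f' := hemb.continuous_iff.2 hf
  have hinj' : Function.Injective f' := fun x y h => hinj (congrArg SetLike.coe h)
  exact hemb.comp (hf'.isClosedEmbedding hinj').isEmbedding

theorem VietorisContinuous.of_comp {Z X Y : Type*} [TopologicalSpace Z] [TopologicalSpace X]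
    [TopologicalSpace Y] {π : Z → X} (hπ : Topology.IsQuotientMap π) {f : X → Set Y}
    (h : VietorisContinuous fun z => f (π z)) : VietorisContinuous f := by
  let := TopologicalSpace.vietoris Y
  exact hπ.continuous_iff.2 h

/-! ### The families of complex projective spaces -/

theorem inner_self_sphere (x : S9) : inner ℝ x.1 x.1 = (1 : ℝ) := by
  rw [real_inner_self_eq_norm_sq, norm_eq_of_mem_sphere x]; norm_num

theorem mem_sphere_of_inner_self {x : R10} (h : inner ℝ x x = (1 : ℝ)) :
    x ∈ Metric.sphere (0 : R10) 1 := by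
  rw [real_inner_self_eq_norm_sq] at h
  rw [mem_sphere_zero_iff_norm]
  rw [← Real.sqrt_sq (norm_nonneg x), h, Real.sqrt_one]

theorem Gr.continuous_compl_pair {X : Type*} [TopologicalSpace X] {p q : X → R10}
    (h : ∀ x, Orthonormal ℝ ![p x, q x]) (hp : Continuous p) (hq : Continuous q) :
    Continuous fun x => Gr.compl ⟨![p x, q x], h x⟩ := by
  refine Gr.continuous_compl.comp (Continuous.subtype_mk (continuous_pi fun i => ?_) _)
  fin_cases i
  · exact hp
  · exact hq

theorem complexLines_eq_range {J : Mat10} (hJ : J ∈ orthogonalComplexStructures) :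
    complexLines J = Set.range fun x : S9 =>
      Gr.compl ⟨![x.1, matAct J x.1], orthonormal_matAct hJ (inner_self_sphere x)⟩ := by
  ext W
  constructor
  · rintro ⟨p, hp⟩
    exact ⟨⟨p, mem_sphere_of_inner_self ((orthonormal_pair_iff _ _).1 hp.orthonormal).1⟩,
      hp.eq_compl.symm⟩
  · rintro ⟨x, rfl⟩
    exact ⟨x.1, Gr.posCompl_compl ⟨![x.1, _], orthonormal_matAct hJ (inner_self_sphere x)⟩⟩

theorem continuous_matAct : Continuous fun w : Mat10 × R10 => matAct w.1 w.2 := by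
  have : Continuous fun w : Mat10 × R10 => w.1.mulVec w.2.ofLp :=
    Continuous.matrix_mulVec continuous_fst ((PiLp.continuous_ofLp 2 _).comp continuous_snd)
  exact (PiLp.continuous_toLp 2 _).comp this

theorem vietorisEmbedding_complexLines {X : Type*} [TopologicalSpace X] [CompactSpace X]
    {K : X → Mat10} (hK : Continuous K) (hinj : Function.Injective K)
    (hmem : ∀ a, K a ∈ orthogonalComplexStructures) :
    VietorisEmbedding fun a => complexLines (K a) := by
  have hF : Continuous fun w : X × S9 => Gr.compl
      ⟨![w.2.1, matAct (K w.1) w.2.1],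
        orthonormal_matAct (hmem w.1) (inner_self_sphere w.2)⟩ := by
    refine Gr.continuous_compl_pair (p := fun w : X × S9 => w.2.1)
      (q := fun w : X × S9 => matAct (K w.1) w.2.1) _ (by fun_prop) ?_
    exact continuous_matAct.comp (f := fun w : X × S9 => (K w.1, w.2.1)) (by fun_prop)
  have e : (fun a => complexLines (K a)) = fun a => Set.range fun x : S9 => Gr.compl
      ⟨![x.1, matAct (K a) x.1], orthonormal_matAct (hmem a) (inner_self_sphere x)⟩ :=
    funext fun a => complexLines_eq_range (hmem a)
  refine VietorisContinuous.embedding ?_ ?_ fun a => ?_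
  · rw [e]
    exact vietorisContinuous_image hF
  · exact fun a b h => hinj (complexLines_injOn (hmem a) (hmem b) h)
  · rw [complexLines_eq_range (hmem a)]
    exact isCompact_range (hF.comp (f := fun x : S9 => (a, x)) (by fun_prop))

theorem disjoint_familyF_familyF' : Disjoint familyF familyF' := by
  rw [Set.disjoint_left]
  rintro _ ⟨J, hJ, rfl⟩ ⟨K, hK, e⟩
  have := complexLines_injOn (JNeg_subset hK) (JPos_subset hJ) e
  exact Set.disjoint_left.1 disjoint_JPos_JNeg hJ (this ▸ hK)

/-! ### Complex structures with a given complex line -/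

/-- The rotation by the angle `t` in the plane of the coordinates `1` and `2`. -/
noncomputable def planeRotation (t : ℝ) : Matrix (Fin 5) (Fin 5) ℝ :=
  !![1, 0, 0, 0, 0; 0, Real.cos t, -Real.sin t, 0, 0; 0, Real.sin t, Real.cos t, 0, 0;
    0, 0, 0, 1, 0; 0, 0, 0, 0, 1]

theorem planeRotation_mul_transpose (t : ℝ) :
    planeRotation t * (planeRotation t).transpose = 1 := by
  have h := Real.cos_sq_add_sin_sq t
  ext i j
  rw [Matrix.mul_apply, Fin.sum_univ_five]
  fin_cases i <;> fin_cases j <;> simp [planeRotation] <;> linarith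

theorem det_planeRotation (t : ℝ) : (planeRotation t).det = 1 := by
  have h := Real.cos_sq_add_sin_sq t
  simp [planeRotation, Matrix.det_succ_row_zero, Fin.sum_univ_succ, Fin.succAbove]
  linarith

/-- The rotation of `ℝ⁵ ⊕ i ℝ⁵` that acts on the first summand only. -/
noncomputable def halfRotation (t : ℝ) : Mat10 :=
  Matrix.reindex (finSumFinEquiv (m := 5) (n := 5)) (finSumFinEquiv (m := 5) (n := 5))
    (Matrix.fromBlocks (planeRotation t) 0 0 1)

theorem halfRotation_apply (t : ℝ) (i j : Fin 5) :
    halfRotation t (Fin.castAdd 5 i) (Fin.castAdd 5 j) = planeRotation t i j ∧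
    halfRotation t (Fin.castAdd 5 i) (Fin.natAdd 5 j) = 0 ∧
    halfRotation t (Fin.natAdd 5 i) (Fin.castAdd 5 j) = 0 ∧
    halfRotation t (Fin.natAdd 5 i) (Fin.natAdd 5 j) = (1 : Matrix _ _ ℝ) i j := by
  simp only [halfRotation, Matrix.reindex_apply, Matrix.submatrix_apply,
    finSumFinEquiv_symm_apply_castAdd, finSumFinEquiv_symm_apply_natAdd]
  simp

theorem halfRotation_mem (t : ℝ) : halfRotation t ∈ Matrix.specialOrthogonalGroup (Fin 10) ℝ := by
  rw [mem_SO10_iff]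
  constructor
  · rw [halfRotation, Matrix.transpose_reindex, Matrix.reindex_apply, Matrix.reindex_apply,
      Matrix.submatrix_mul_equiv, Matrix.fromBlocks_transpose, Matrix.fromBlocks_multiply]
    simp [planeRotation_mul_transpose]
  · rw [halfRotation, Matrix.det_reindex_self, Matrix.det_fromBlocks_zero₂₁, det_planeRotation]
    simp

theorem matAct_transpose_of_matAct {g : SO10} {x y : R10} (h : matAct g.1 x = y) :
    matAct g.1.transpose y = x := by
  rw [← h, ← matAct_mul, SO10_transpose_mul, matAct_one]

theorem matAct_conjJ0 {g : SO10} {x y : R10} (h : matAct g.1 x = y) :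
    matAct (conjJ0 g) y = matAct g.1 (matAct J0 x) := by
  rw [conjJ0, SO10_coe_inv, matAct_mul, matAct_mul, matAct_transpose_of_matAct h]

/-- The standard vectors 0 and 5 are chosen because $J_0$ sends the first to the second. A basis
with determinant $-1$ is corrected by exchanging entries 1 and 2, which disturbs neither. -/
theorem exists_rotation {p q : R10} (h : Orthonormal ℝ ![p, q]) :
    ∃ g : SO10, matAct g.1 (stdVec 0) = p ∧ matAct g.1 (stdVec 5) = q := by
  obtain ⟨W, A, -, hA, hd⟩ := exists_posCompl_of_orthonormal h
  change Orthonormal ℝ (append82 A.1 ![p, q]) at hA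
  obtain ⟨σ, hσ8, hσ9⟩ := exists_perm_of_ne (k := 0) (l := 5) (by decide)
  have hb : Orthonormal ℝ (append82 A.1 ![p, q] ∘ σ.symm) := hA.comp _ σ.symm.injective
  have h0 : (append82 A.1 ![p, q] ∘ σ.symm) 0 = p := by
    rw [Function.comp_apply, ← hσ8, Equiv.symm_apply_apply]
    exact append82_inr A.1 ![p, q] 0
  have h5 : (append82 A.1 ![p, q] ∘ σ.symm) 5 = q := by
    rw [Function.comp_apply, ← hσ9, Equiv.symm_apply_apply]
    exact append82_inr A.1 ![p, q] 1
  generalize append82 A.1 ![p, q] ∘ σ.symm = b at hb h0 h5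
  have key : ∀ c : Fin 10 → R10, Orthonormal ℝ c → (rowMatrix c).det = 1 →
      ∃ g : SO10, ∀ i, matAct g.1 (stdVec i) = c i := by
    intro c hc hdet
    refine ⟨⟨(rowMatrix c).transpose, mem_SO10_iff.2 ⟨?_, ?_⟩⟩, fun i => ?_⟩
    · rw [← Matrix.transpose_mul]
      have := (orthonormal_iff_gramOf c).1 hc
      rw [← rowMatrix_mul_transpose, mul_eq_one_comm] at this
      rw [Matrix.transpose_mul, Matrix.transpose_transpose, this]
    · rw [Matrix.det_transpose, hdet]
    · ext k
      rw [matAct_stdVec]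
      rfl
  have hdd := det_rowMatrix_mul_det_rowMatrix b b
  rw [(orthonormal_iff_gramOf b).1 hb, Matrix.det_one] at hdd
  rcases mul_self_eq_one_iff.1 hdd with hd1 | hd1
  · obtain ⟨g, hg⟩ := key b hb hd1
    exact ⟨g, (hg 0).trans h0, (hg 5).trans h5⟩
  · obtain ⟨g, hg⟩ := key (b ∘ Equiv.swap 1 2) (hb.comp _ (Equiv.injective _)) (by
      have e : rowMatrix (b ∘ Equiv.swap 1 2) = (rowMatrix b).submatrix (Equiv.swap 1 2) id := rfl
      rw [e, Matrix.det_permute, Equiv.Perm.sign_swap (by decide), hd1]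
      simp)
    exact ⟨g, (hg 0).trans h0, (hg 5).trans h5⟩

/-- Conjugate $J_0$ by $g r_t$, where $g$ carries the standard pair to $(p,q)$ and $r_t$ rotates
coordinates 1 and 2 while fixing $e_0$ and all of $i\mathbb R^5$. The line $(p,q)$ stays complex,
but $r_t$ is not unitary for general $t$, so the structure moves. -/
theorem infinite_JPos_matAct {p q : R10} (h : Orthonormal ℝ ![p, q]) :
    {J ∈ JPos | matAct J p = q}.Infinite := by
  obtain ⟨g, hp, hq⟩ := exists_rotation h
  let r : ℝ → SO10 := fun t => ⟨halfRotation t, halfRotation_mem t⟩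
  have hr0 : ∀ t, matAct (r t).1 (stdVec 0) = stdVec 0 := by
    intro t
    change matAct (halfRotation t) (stdVec (Fin.castAdd 5 0)) = stdVec (Fin.castAdd 5 0)
    ext k
    rw [matAct_stdVec]
    revert k
    rw [forall_fin_ten]
    simp only [halfRotation_apply, stdVec_apply_split, implies_true, and_true]
    intro i
    fin_cases i <;> simp [planeRotation]
  have hrn : ∀ t, ∀ i : Fin 5, matAct (r t).1 (stdVec (Fin.natAdd 5 i)) = stdVec (Fin.natAdd 5 i) := by
    intro t j
    ext k
    rw [matAct_stdVec]
    revert k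
    rw [forall_fin_ten]
    change (∀ i, halfRotation t _ _ = _) ∧ (∀ i, halfRotation t _ _ = _)
    simp only [halfRotation_apply, stdVec_apply_split, implies_true, true_and, Matrix.one_apply]
  have hJ5 : matAct J0 (stdVec 0) = stdVec 5 := (matAct_J0_stdVec 0).1
  refine Set.infinite_of_injOn_mapsTo (f := fun t => conjJ0 (g * r t)) (s := Set.Icc 0 Real.pi)
    ?_ ?_ (Set.Icc_infinite Real.pi_pos)
  · intro s hs t ht e
    refine Real.injOn_cos hs ht ?_
    -- The vector sent to $ge_6$ by the structure at time $t$ is $g r_t e_1$. It can be recovered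
    -- from the structure, and the coordinate $\cos t$ of $r_te_1$ is injective on $[0,\pi]$.
    have e1 : ∀ t, matAct (conjJ0 (g * r t)) (matAct g.1 (matAct (r t).1
        (stdVec (Fin.castAdd 5 1)))) = matAct g.1 (stdVec (Fin.natAdd 5 (1 : Fin 5))) := by
      intro t
      rw [matAct_conjJ0 (matAct_mul _ _ _), (matAct_J0_stdVec _).1]
      change matAct (g.1 * (r t).1) _ = _
      rw [matAct_mul, hrn]
    have e2 := e1 s
    rw [show conjJ0 (g * r s) = conjJ0 (g * r t) from e, ← e1 t] at e2
    have e3 := congrArg (matAct (conjJ0 (g * r t))) e2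
    rw [matAct_matAct (conjJ0_mem _).2, matAct_matAct (conjJ0_mem _).2, neg_inj] at e3
    have e4 := congrArg (matAct g.1.transpose) e3
    rw [matAct_transpose_of_matAct rfl, matAct_transpose_of_matAct rfl] at e4
    have e5 := congrArg (fun v : R10 => v (Fin.castAdd 5 1)) e4
    simp only [matAct_stdVec] at e5
    change halfRotation s _ _ = halfRotation t _ _ at e5
    rw [(halfRotation_apply _ _ _).1, (halfRotation_apply _ _ _).1] at e5
    simpa [planeRotation] using e5
  · intro t _
    refine ⟨JPos_eq ▸ ⟨_, rfl⟩, ?_⟩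
    have h1 : matAct (g * r t).1 (stdVec 0) = p := by
      change matAct (g.1 * (r t).1) _ = _
      rw [matAct_mul, hr0, hp]
    have h2 : matAct (g * r t).1 (stdVec 5) = q := by
      change matAct (g.1 * (r t).1) (stdVec (Fin.natAdd 5 (0 : Fin 5))) = _
      rw [matAct_mul, hrn]
      exact hq
    rw [matAct_conjJ0 h1, hJ5, h2]

theorem infinite_familyF (W : Gr 8) : {C ∈ familyF | W ∈ C}.Infinite := by
  obtain ⟨p, q, h⟩ := exists_posCompl W
  refine Set.infinite_of_injOn_mapsTo (f := complexLines) ?_ ?_ (infinite_JPos_matAct h.orthonormal)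
  · exact complexLines_injOn.mono fun J hJ => JPos_subset hJ.1
  · rintro J ⟨hJ, e⟩
    exact ⟨⟨J, hJ, rfl⟩, (mem_complexLines_iff (JPos_subset hJ) h).2 e⟩

/-- If a positive structure satisfies $Jq=p$, then $-J$ is negative and sends $p$ to $q$; so the
positive case is applied to the reversed pair. -/
theorem infinite_familyF' (W : Gr 8) : {C ∈ familyF' | W ∈ C}.Infinite := by
  obtain ⟨p, q, h⟩ := exists_posCompl W
  have ho : Orthonormal ℝ ![q, p] := by
    have := (orthonormal_pair_iff _ _).1 h.orthonormal
    exact (orthonormal_pair_iff _ _).2 ⟨this.2.1, this.1, (real_inner_comm _ _).trans this.2.2⟩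
  refine Set.infinite_of_injOn_mapsTo (f := fun J => complexLines (-J)) ?_ ?_
    (infinite_JPos_matAct ho)
  · intro J hJ K hK e
    exact neg_inj.1 (complexLines_injOn
      (neg_mem_orthogonalComplexStructures (JPos_subset hJ.1))
      (neg_mem_orthogonalComplexStructures (JPos_subset hK.1)) e)
  · rintro J ⟨hJ, e⟩
    have hJ' := neg_mem_orthogonalComplexStructures (JPos_subset hJ)
    refine ⟨⟨-J, mem_JNeg_iff.2 (by rwa [neg_neg]), rfl⟩, (mem_complexLines_iff hJ' h).2 ?_⟩
    rw [← e, neg_matAct, matAct_matAct (JPos_subset hJ).2, neg_neg]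

/-! ### Oriented hyperplanes -/

/-- The family of the nine vectors `e` followed by `u`. -/
def snoc91 (e : Fin 9 → R10) (u : R10) : Fin 10 → R10 := Fin.snoc (α := fun _ => R10) e u

theorem snoc91_castSucc (e : Fin 9 → R10) (u : R10) (i : Fin 9) :
    snoc91 e u (Fin.castSucc i) = e i := Fin.snoc_castSucc (α := fun _ => R10) _ _ _

theorem snoc91_last (e : Fin 9 → R10) (u : R10) : snoc91 e u (Fin.last 9) = u :=
  Fin.snoc_last (α := fun _ => R10) _ _

theorem orthonormal_snoc91_iff (e : Fin 9 → R10) (u : R10) :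
    Orthonormal ℝ (snoc91 e u) ↔
      Orthonormal ℝ e ∧ inner ℝ u u = (1 : ℝ) ∧ ∀ i, inner ℝ (e i) u = (0 : ℝ) := by
  rw [orthonormal_iff_ite, orthonormal_iff_ite, Fin.forall_fin_succ']
  simp only [Fin.forall_fin_succ' (n := 9), snoc91_castSucc, snoc91_last, Fin.castSucc_inj,
    (Fin.castSucc_lt_last _).ne, (Fin.castSucc_lt_last _).ne', if_false, if_true]
  constructor
  · rintro ⟨h1, h2, h3⟩
    exact ⟨fun i => (h1 i).1, h3, fun i => (h1 i).2⟩
  · rintro ⟨h1, h2, h3⟩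
    exact ⟨fun i => ⟨h1 i, h3 i⟩, fun i => (real_inner_comm _ _).trans (h3 i), h2⟩

theorem det_snoc91_mul {e e' : Fin 9 → R10} {u : R10} (hu : inner ℝ u u = (1 : ℝ))
    (he : ∀ i, inner ℝ (e i) u = (0 : ℝ)) (he' : ∀ i, inner ℝ (e' i) u = (0 : ℝ)) :
    (rowMatrix (snoc91 e u)).det * (rowMatrix (snoc91 e' u)).det = (gramOf e e').det := by
  have e0 : (gramOf (snoc91 e u) (snoc91 e' u)).submatrix (finSumFinEquiv (m := 9) (n := 1))
      (finSumFinEquiv (m := 9) (n := 1)) = Matrix.fromBlocks (gramOf e e') 0 0 1 := by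
    have h1 : ∀ (f : Fin 9 → R10) i, snoc91 f u (finSumFinEquiv (m := 9) (n := 1) (Sum.inl i)) =
      f i := fun f i => snoc91_castSucc f u i
    have h2 : ∀ (f : Fin 9 → R10) (i : Fin 1), snoc91 f u (finSumFinEquiv (m := 9) (n := 1)
      (Sum.inr i)) = u := fun f i => by rw [Subsingleton.elim i 0]; exact snoc91_last f u
    ext (i | i) (j | j) <;>
      simp only [gramOf, Matrix.submatrix_apply, Matrix.of_apply, h1, h2,
        Matrix.fromBlocks_apply₁₁, Matrix.fromBlocks_apply₁₂, Matrix.fromBlocks_apply₂₁,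
        Matrix.fromBlocks_apply₂₂, he, hu]
    · rfl
    · rw [real_inner_comm, he']; rfl
    · rw [Subsingleton.elim i j, Matrix.one_apply_eq]
  rw [det_rowMatrix_mul_det_rowMatrix,
    ← Matrix.det_submatrix_equiv_self (finSumFinEquiv (m := 9) (n := 1)), e0,
    Matrix.det_fromBlocks_zero₂₁, Matrix.det_one, mul_one]

theorem exists_isHyperplaneBasis {u : R10} (hu : inner ℝ u u = (1 : ℝ)) :
    ∃ e, IsHyperplaneBasis u e := by
  have hs : Orthonormal ℝ (({Fin.last 9} : Set (Fin 10)).domRestrict fun _ => u) := by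
    rw [orthonormal_iff_ite]
    rintro ⟨_, rfl⟩ ⟨_, rfl⟩
    simpa using! hu
  obtain ⟨b, hb⟩ := Orthonormal.exists_orthonormalBasis_extension_of_card_eq (by simp) hs
  have hb9 : b (Fin.last 9) = u := hb _ rfl
  have e1 : snoc91 (fun i => b (Fin.castSucc i)) u = b := by
    funext i
    refine Fin.lastCases ?_ (fun i => ?_) i
    · rw [snoc91_last, hb9]
    · rw [snoc91_castSucc]
  have ho : Orthonormal ℝ (snoc91 (fun i => b (Fin.castSucc i)) u) := by
    rw [e1]
    exact b.orthonormal
  by_cases hpos : 0 < (rowMatrix (snoc91 (fun i => b (Fin.castSucc i)) u)).det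
  · exact ⟨_, ho, hpos⟩
  · obtain ⟨h1, h2, h3⟩ := (orthonormal_snoc91_iff _ _).1 ho
    have h4 : Orthonormal ℝ (snoc91 ((fun i => b (Fin.castSucc i)) ∘ Equiv.swap 0 1) u) :=
      (orthonormal_snoc91_iff _ _).2 ⟨h1.comp _ (Equiv.injective _), h2, fun i => h3 _⟩
    refine ⟨_, h4, ?_⟩
    have hd := det_snoc91_mul h2 (fun i => h3 (Equiv.swap 0 1 i)) h3
    have e2 : gramOf (fun i => b (Fin.castSucc (Equiv.swap 0 1 i))) (fun i => b (Fin.castSucc i)) =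
        (gramOf (fun i => b (Fin.castSucc i)) fun i => b (Fin.castSucc i)).submatrix
          (Equiv.swap 0 1) id := rfl
    rw [e2, Matrix.det_permute, (orthonormal_iff_gramOf _).1 h1,
      Equiv.Perm.sign_swap (by decide)] at hd
    change 0 < (rowMatrix (snoc91 (fun i => b (Fin.castSucc (Equiv.swap 0 1 i))) u)).det
    simp only [Matrix.det_one, mul_one, Units.val_neg, Units.val_one, Int.cast_neg,
      Int.cast_one] at hd
    nlinarith

/-- The linear combination of the vectors `e` with coefficients `y`. -/
noncomputable def combine (e : Fin 9 → R10) (y : R9) : R10 := ∑ i, y i • e i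

theorem inner_combine (e : Fin 9 → R10) (y : R9) (x : R10) :
    inner ℝ (combine e y) x = ∑ i, y i * (inner ℝ (e i) x : ℝ) := by
  simp only [combine, sum_inner, real_inner_smul_left]

theorem IsHyperplaneBasis.orthonormal {u : R10} {e : Fin 9 → R10} (h : IsHyperplaneBasis u e) :
    Orthonormal ℝ e := ((orthonormal_snoc91_iff _ _).1 h.1).1

theorem IsHyperplaneBasis.inner_self {u : R10} {e : Fin 9 → R10} (h : IsHyperplaneBasis u e) :
    inner ℝ u u = (1 : ℝ) := ((orthonormal_snoc91_iff _ _).1 h.1).2.1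

theorem IsHyperplaneBasis.inner_right {u : R10} {e : Fin 9 → R10} (h : IsHyperplaneBasis u e)
    (i : Fin 9) : inner ℝ (e i) u = (0 : ℝ) := ((orthonormal_snoc91_iff _ _).1 h.1).2.2 i

theorem IsHyperplaneBasis.det_eq_one {u : R10} {e : Fin 9 → R10} (h : IsHyperplaneBasis u e) :
    (rowMatrix (snoc91 e u)).det = 1 := IsPosBasis.det_eq_one h

theorem IsHyperplaneBasis.inner_combine_right {u : R10} {e : Fin 9 → R10}
    (h : IsHyperplaneBasis u e) (y : R9) : inner ℝ (combine e y) u = (0 : ℝ) := by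
  simp [inner_combine, h.inner_right]

theorem inner_combine_left {e : Fin 9 → R10} (h : Orthonormal ℝ e) (i : Fin 9) (y : R9) :
    inner ℝ (e i) (combine e y) = y i := by
  rw [real_inner_comm, inner_combine]
  simp [orthonormal_iff_ite.1 h]

theorem inner_combine_combine {e : Fin 9 → R10} (h : Orthonormal ℝ e) (y y' : R9) :
    inner ℝ (combine e y) (combine e y') = (inner ℝ y y' : ℝ) := by
  rw [inner_combine, inner_eq_sum]
  simp only [inner_combine_left h]

theorem IsHyperplaneBasis.eq_combine {u : R10} {e : Fin 9 → R10} (h : IsHyperplaneBasis u e)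
    {x : R10} (hx : inner ℝ x u = (0 : ℝ)) :
    x = combine e (WithLp.toLp 2 fun i => inner ℝ (e i) x) := by
  have ho : Orthonormal ℝ (snoc91 e u) := h.1
  have hs : ⊤ ≤ Submodule.span ℝ (Set.range (snoc91 e u)) := by
    rw [ho.linearIndependent.span_eq_top_of_card_eq_finrank (by simp)]
  have := (OrthonormalBasis.mk ho hs).sum_repr' x
  simp only [OrthonormalBasis.coe_mk] at this
  rw [Fin.sum_univ_castSucc] at this
  simp only [snoc91_castSucc, snoc91_last] at this
  rw [real_inner_comm, hx, zero_smul, add_zero] at this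
  exact this.symm

/-! ### Planes in a hyperplane -/

theorem wedge_neg_neg (p q : R10) : wedge (-p) (-q) = wedge p q := by
  ext k l; simp [wedge]

theorem wedge_neg_right_swap (p q : R10) : wedge p (-q) = wedge q p := by
  ext k l; simp [wedge]; ring

theorem posCompl_neg_neg {W : Gr 8} {p q : R10} : PosCompl W (-p) (-q) ↔ PosCompl W p q := by
  rw [posCompl_iff, posCompl_iff, wedge_neg_neg, orthonormal_pair_iff, orthonormal_pair_iff]
  simp only [inner_neg_neg]

theorem posCompl_neg_right {W : Gr 8} {p q : R10} : PosCompl W p (-q) ↔ PosCompl W q p := by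
  rw [posCompl_iff, posCompl_iff, wedge_neg_right_swap, orthonormal_pair_iff, orthonormal_pair_iff,
    inner_neg_neg, inner_neg_right, neg_eq_zero, real_inner_comm q p]
  tauto

/-- From $u\wedge x=x\wedge(-u)$. It transfers the results on the first family of spheres to the
second. -/
theorem markedH'_eq (u : R10) : markedH' u = markedH (-u) := by
  ext w
  exact posCompl_neg_right.symm

theorem PosCompl.combination {W : Gr 8} {p q : R10} (h : PosCompl W p q) {a b : ℝ}
    (hab : a ^ 2 + b ^ 2 = 1) : PosCompl W (b • p - a • q) (a • p + b • q) := by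
  obtain ⟨ho, e⟩ := posCompl_iff.1 h
  obtain ⟨h1, h2, h3⟩ := (orthonormal_pair_iff _ _).1 ho
  have h3' : inner ℝ q p = (0 : ℝ) := (real_inner_comm _ _).trans h3
  refine posCompl_iff.2 ⟨(orthonormal_pair_iff _ _).2 ?_, ?_⟩
  · simp only [inner_sub_left, inner_sub_right, inner_add_left, inner_add_right,
      real_inner_smul_left, real_inner_smul_right, h1, h2, h3, h3']
    refine ⟨?_, ?_, ?_⟩ <;> linarith
  · rw [e]
    ext k l
    simp only [wedge, Matrix.of_apply, PiLp.sub_apply, PiLp.add_apply, PiLp.smul_apply,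
      smul_eq_mul]
    linear_combination -(p k * q l - q k * p l) * hab

/-- A plane lies in $u^\perp$ exactly when $u$ lies in its complement. Then $u=ap+bq$ with
$a^2+b^2=1$, and a rotation of $(p,q)$ puts $u$ in second place. -/
theorem mem_planesIn_iff {W : Gr 8} {u : R10} (hu : inner ℝ u u = (1 : ℝ)) :
    W ∈ planesIn u ↔ ∃ x, PosCompl W x u := by
  constructor
  · rintro ⟨A, rfl, hA⟩
    obtain ⟨p, q, h⟩ := exists_posCompl (Gr.mk A)
    have h' := h
    obtain ⟨A', hAA', h''⟩ := h
    obtain ⟨g, -, hg⟩ := Quotient.exact hAA'.symm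
    have hA' : ∀ i, inner ℝ u (A'.1 i) = (0 : ℝ) := fun i => by
      rw [hg, inner_sum]
      refine Finset.sum_eq_zero fun j _ => ?_
      rw [real_inner_smul_right, real_inner_comm, hA, mul_zero]
    have hexp := eq_sum_of_orthonormal_append82 (p := p) (q := q) h''.1 u
    simp only [fun i => (real_inner_comm u (A'.1 i)).trans (hA' i), zero_smul,
      Finset.sum_const_zero, zero_add] at hexp
    obtain ⟨h1, h2, h3⟩ := (orthonormal_pair_iff _ _).1 h'.orthonormal
    have hab : (inner ℝ p u : ℝ) ^ 2 + (inner ℝ q u : ℝ) ^ 2 = 1 := by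
      have := hu
      nth_rw 1 [hexp] at this
      rw [inner_add_left, real_inner_smul_left, real_inner_smul_left] at this
      linarith
    have := h'.combination hab
    rw [← hexp] at this
    exact ⟨_, this⟩
  · rintro ⟨x, A, rfl, h⟩
    exact ⟨A, rfl, fun i => ((orthonormal_append82_iff _ _).1 h.1).2.2 i 1⟩

theorem mem_planesThrough_iff {W : Gr 8} {u : R10} :
    W ∈ planesThrough u ↔ ∃ x, PosCompl W x u := by
  constructor
  · rintro ⟨x, h⟩
    exact ⟨-x, posCompl_neg_right.1 (by rwa [neg_neg])⟩
  · rintro ⟨x, h⟩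
    exact ⟨-x, posCompl_neg_right.2 h⟩

theorem planesThrough_eq {u : R10} (hu : inner ℝ u u = (1 : ℝ)) : planesThrough u = planesIn u := by
  ext W
  rw [mem_planesThrough_iff, mem_planesIn_iff hu]

theorem planesIn_neg (u : R10) : planesIn (-u) = planesIn u := by
  simp only [planesIn, inner_neg_right, neg_eq_zero]

/-- The complements $e_i\wedge u$ all have to contain $v$, and two of these planes meet only in the
line of $u$. -/
theorem eq_or_eq_neg_of_planesIn_eq {u v : R10} (hu : inner ℝ u u = (1 : ℝ))
    (hv : inner ℝ v v = (1 : ℝ)) (h : planesIn u = planesIn v) : u = v ∨ u = -v := by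
  obtain ⟨e, he⟩ := exists_isHyperplaneBasis hu
  have ho := orthonormal_iff_ite.1 he.orthonormal
  have key : ∀ i, v = (inner ℝ (e i) v : ℝ) • e i + (inner ℝ u v : ℝ) • u := by
    intro i
    have ho' : Orthonormal ℝ ![e i, u] :=
      (orthonormal_pair_iff _ _).2 ⟨by simpa using ho i i, hu, he.inner_right i⟩
    obtain ⟨W, hW⟩ := exists_posCompl_of_orthonormal ho'
    have hW' : W ∈ planesIn v := h ▸ (mem_planesIn_iff hu).2 ⟨_, hW⟩
    obtain ⟨x, hx⟩ := (mem_planesIn_iff hv).1 hW'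
    have e1 := hW.form_eq.symm.trans hx.form_eq
    -- The square of the bivector is $-1$ on its plane, so this identity expresses $v$ through $e_i$
    -- and $u$.
    have e2 : matAct (wedge (e i) u) (matAct (wedge (e i) u) v) = -v := by
      rw [e1, matAct_wedge_right hx.orthonormal, matAct_wedge_left hx.orthonormal]
    rw [matAct_wedge _ _ v, sub_eq_add_neg, ← smul_neg, matAct_add, matAct_smul, matAct_smul,
      matAct_neg, matAct_wedge_left ho', matAct_wedge_right ho'] at e2
    rw [← neg_inj, ← e2]
    module
  have h0 : inner ℝ (e 0) v = (0 : ℝ) := by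
    have h1 := key 1
    rw [h1, inner_add_right, real_inner_smul_right, real_inner_smul_right, he.inner_right, ho]
    simp
  have h2 := key 0
  rw [h0, zero_smul, zero_add] at h2
  have h3 : (inner ℝ u v : ℝ) * inner ℝ u v = 1 := by
    nth_rw 1 [← real_inner_smul_left, ← h2, hv]
  rcases mul_self_eq_one_iff.1 h3 with h4 | h4
  · left; rw [h2, h4, one_smul]
  · right; rw [h2, h4]; simp

theorem planesIn_eq_iff {u v : R10} (hu : inner ℝ u u = (1 : ℝ)) (hv : inner ℝ v v = (1 : ℝ)) :
    planesIn u = planesIn v ↔ u = v ∨ u = -v := by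
  refine ⟨eq_or_eq_neg_of_planesIn_eq hu hv, ?_⟩
  rintro (rfl | rfl)
  · rfl
  · exact planesIn_neg v

/-! ### Oriented spheres -/

/-- The maps `y ↦ compl (x ∧ w)`, `x = ∑ yᵢ eᵢ`, for all positive orthonormal bases `e` of the
oriented hyperplane `u^⊥`. -/
def sphereOf (u w : R10) : Set (S8 → Gr 8) :=
  {f | ∃ e, IsHyperplaneBasis u e ∧ ∀ y : S8, PosCompl (f y) (combine e y.1) w}

theorem sphereH_eq (u : R10) : sphereH u = sphereOf u u := rfl

theorem sphereH'_eq (u : R10) : sphereH' u = sphereOf u (-u) := by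
  simp only [sphereH', markedH'_eq]
  rfl

theorem inner_self_sphere8 (y : S8) : inner ℝ y.1 y.1 = (1 : ℝ) := by
  rw [real_inner_self_eq_norm_sq, norm_eq_of_mem_sphere y]; norm_num

theorem IsHyperplaneBasis.orthonormal_combine {u w : R10} {e : Fin 9 → R10}
    (h : IsHyperplaneBasis u e) (hw : w = u ∨ w = -u) (y : S8) :
    Orthonormal ℝ ![combine e y.1, w] := by
  rw [orthonormal_pair_iff, inner_combine_combine h.orthonormal, inner_self_sphere8]
  rcases hw with rfl | rfl
  · exact ⟨rfl, h.inner_self, h.inner_combine_right _⟩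
  · rw [inner_neg_neg, inner_neg_right, h.inner_combine_right, neg_zero]
    exact ⟨rfl, h.inner_self, rfl⟩

theorem IsHyperplaneBasis.exists_mem_sphereOf {u w : R10} {e : Fin 9 → R10}
    (h : IsHyperplaneBasis u e) (hw : w = u ∨ w = -u) :
    ∃ f : S8 → Gr 8, ∀ y : S8, PosCompl (f y) (combine e y.1) w :=
  ⟨fun y => Gr.compl ⟨_, h.orthonormal_combine hw y⟩, fun y =>
    Gr.posCompl_compl ⟨_, h.orthonormal_combine hw y⟩⟩

/-- The inverse is linear in Plücker coordinates: the bivector $x\wedge w$ applied to $w$ returns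
$x$, whose coordinates in $e$ form the point of the sphere. -/
theorem isSmoothEmbeddingVia_of_posCompl {w : R10} {e : Fin 9 → R10} (he : Orthonormal ℝ e)
    {f : S8 → Gr 8} (hf : ∀ y : S8, PosCompl (f y) (combine e y.1) w) :
    IsSmoothEmbeddingVia (fun y : S8 => (y : R9)) Gr.plucker f := by
  let g : ((Fin 8 → Fin 10) → ℝ) → R9 := fun P =>
    WithLp.toLp 2 fun i => ∑ k, e i k * ∑ l, pluckerToForm P k l * w l
  have hg : ContDiff ℝ ∞ g := by
    rw [contDiff_euclidean]
    intro i
    have := contDiff_pluckerToForm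
    change ContDiff ℝ ∞ fun P => ∑ k, e i k * ∑ l, pluckerToForm P k l * w l
    exact ContDiff.sum fun k _ => contDiff_const.mul
      (ContDiff.sum fun l _ => (this k l).mul contDiff_const)
  have hinv : ∀ y, g (f y).plucker = (y : R9) := by
    intro y
    have h1 : matAct (pluckerToForm (f y).plucker) w = combine e y.1 := by
      change matAct (f y).form w = _
      rw [(hf y).form_eq, matAct_wedge_right (hf y).orthonormal]
    ext i
    rw [← inner_combine_left he i y.1, ← h1, inner_eq_sum]
    rfl
  refine ⟨fun y y' h => Subtype.ext ?_, ?_, .of_contDiff hg hinv⟩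
  · rw [← hinv, h, hinv]
  · refine .of_contDiff (g := fun y => formToPlucker (wedge (combine e y) w)) ?_ fun y => ?_
    · refine contDiff_formToPlucker fun k l => ?_
      simp only [wedge, Matrix.of_apply, combine, WithLp.ofLp_sum, Finset.sum_apply,
        PiLp.smul_apply, smul_eq_mul]
      fun_prop
    · rw [Function.comp_apply, ← (hf y).form_eq, Gr.formToPlucker_form]

theorem gramOf_combine {e : Fin 9 → R10} (he : Orthonormal ℝ e) (g : R9 →ₗ[ℝ] R9) :
    (gramOf e fun i => combine e (g (EuclideanSpace.single i 1))).det = LinearMap.det g := by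
  rw [← LinearMap.det_toMatrix (EuclideanSpace.basisFun (Fin 9) ℝ).toBasis]
  congr 1
  ext i j
  simp only [gramOf, Matrix.of_apply, inner_combine_left he]
  simp [LinearMap.toMatrix_apply]

theorem combine_map (e : Fin 9 → R10) (g : R9 →ₗ[ℝ] R9) (y : R9) :
    combine (fun i => combine e (g (EuclideanSpace.single i 1))) y = combine e (g y) := by
  have hy : y = ∑ i, y i • EuclideanSpace.single i (1 : ℝ) := by
    ext j; simp [Pi.single_apply]
  have hlin : ∀ z : R9, combine e z = Fintype.linearCombination ℝ e z.ofLp := fun z => by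
    simp [combine, Fintype.linearCombination_apply]
  conv_rhs => rw [hy, map_sum]
  simp only [combine, map_smul, WithLp.ofLp_sum, Finset.sum_apply, PiLp.smul_apply, smul_eq_mul,
    Finset.smul_sum, Finset.sum_smul, mul_smul]
  exact Finset.sum_comm

theorem IsHyperplaneBasis.comp_isometry {u : R10} {e : Fin 9 → R10} (h : IsHyperplaneBasis u e)
    (g : R9 ≃ₗᵢ[ℝ] R9) (hg : 0 < LinearMap.det (g.toLinearEquiv : R9 →ₗ[ℝ] R9)) :
    IsHyperplaneBasis u fun i => combine e (g (EuclideanSpace.single i 1)) := by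
  have ho : Orthonormal ℝ fun i => combine e (g (EuclideanSpace.single i 1)) := by
    rw [orthonormal_iff_ite]
    intro i j
    rw [inner_combine_combine h.orthonormal, LinearIsometryEquiv.inner_map_map]
    simp [EuclideanSpace.inner_single_left]
  refine ⟨(orthonormal_snoc91_iff _ _).2 ⟨ho, h.inner_self, fun i => h.inner_combine_right _⟩, ?_⟩
  have hd := det_snoc91_mul h.inner_self h.inner_right fun i =>
    h.inner_combine_right (g (EuclideanSpace.single i 1))
  rw [h.det_eq_one, one_mul] at hd
  have hd' := hd.trans (gramOf_combine h.orthonormal (g.toLinearEquiv : R9 →ₗ[ℝ] R9))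
  change 0 < (rowMatrix (snoc91 _ u)).det
  rw [hd']
  exact hg

/-- Positive bases of the oriented hyperplane form a single orbit of rotations. With
`IsHyperplaneBasis.comp_isometry` this shows that the maps in `sphereOf` are one embedding up to
rotations of $S^8$. -/
theorem IsHyperplaneBasis.exists_isometry {u : R10} {e e' : Fin 9 → R10}
    (h : IsHyperplaneBasis u e) (h' : IsHyperplaneBasis u e') :
    ∃ g : R9 ≃ₗᵢ[ℝ] R9, 0 < LinearMap.det (g.toLinearEquiv : R9 →ₗ[ℝ] R9) ∧
      ∀ y, combine e' y = combine e (g y) := by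
  let L : R9 →ₗ[ℝ] R9 :=
    { toFun := fun y => WithLp.toLp 2 fun i => inner ℝ (e i) (combine e' y)
      map_add' := fun y y' => by
        ext i
        simp [combine, add_smul, Finset.sum_add_distrib, inner_add_right]
      map_smul' := fun r y => by
        ext i
        simp [combine, mul_smul, ← Finset.smul_sum, real_inner_smul_right] }
  have hL : ∀ y, combine e' y = combine e (L y) := fun y =>
    h.eq_combine (h'.inner_combine_right y)
  let g : R9 ≃ₗᵢ[ℝ] R9 := LinearIsometry.toLinearIsometryEquiv
    { toLinearMap := L
      norm_map' := fun y => by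
        have h1 := inner_combine_combine h'.orthonormal y y
        rw [hL, inner_combine_combine h.orthonormal, real_inner_self_eq_norm_sq,
          real_inner_self_eq_norm_sq] at h1
        exact (sq_eq_sq₀ (norm_nonneg _) (norm_nonneg _)).1 h1 } rfl
  have hgL : (g.toLinearEquiv : R9 →ₗ[ℝ] R9) = L := by
    ext y
    rfl
  refine ⟨g, ?_, fun y => hL y⟩
  have he' : e' = fun i => combine e (L (EuclideanSpace.single i 1)) := by
    funext i
    rw [← hL]
    simp [combine]
  have hd := det_snoc91_mul h.inner_self h.inner_right h'.inner_right
  rw [h.det_eq_one, h'.det_eq_one, he', gramOf_combine h.orthonormal] at hd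
  rw [hgL, ← hd]
  norm_num

theorem PosCompl.unique {W W' : Gr 8} {p q : R10} (h : PosCompl W p q) (h' : PosCompl W' p q) :
    W = W' :=
  Gr.form_injective (h.form_eq.trans h'.form_eq.symm)

theorem isOrientedSphere_sphereOf {u w : R10} (hu : inner ℝ u u = (1 : ℝ))
    (hw : w = u ∨ w = -u) : IsOrientedSphere (sphereOf u w) := by
  obtain ⟨e, he⟩ := exists_isHyperplaneBasis hu
  obtain ⟨f₀, hf₀⟩ := he.exists_mem_sphereOf hw
  refine ⟨f₀, isSmoothEmbeddingVia_of_posCompl he.orthonormal hf₀, ?_⟩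
  ext f
  constructor
  · rintro ⟨e', he', hf⟩
    obtain ⟨g, hg, hgc⟩ := he.exists_isometry he'
    refine ⟨g, hg, fun y => (hf y).unique ?_⟩
    rw [hgc]
    exact hf₀ ⟨g y, _⟩
  · rintro ⟨g, hg, hf⟩
    refine ⟨_, he.comp_isometry g hg, fun y => ?_⟩
    rw [hf]
    have := hf₀ ⟨g y, by simp⟩
    have hc := combine_map e (g.toLinearEquiv : R9 →ₗ[ℝ] R9) y.1
    exact hc ▸ this

theorem IsHyperplaneBasis.exists_combine {u x : R10} {e : Fin 9 → R10}
    (h : IsHyperplaneBasis u e) (hx : inner ℝ x x = (1 : ℝ)) (hxu : inner ℝ x u = (0 : ℝ)) :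
    ∃ y : S8, combine e y.1 = x := by
  have hxe := h.eq_combine hxu
  set y : R9 := WithLp.toLp 2 fun i => inner ℝ (e i) x
  refine ⟨⟨y, ?_⟩, hxe.symm⟩
  rw [hxe, inner_combine_combine h.orthonormal, real_inner_self_eq_norm_sq] at hx
  rw [mem_sphere_zero_iff_norm, ← Real.sqrt_sq (norm_nonneg y), hx, Real.sqrt_one]

theorem sphereSupport_sphereOf {u w : R10} (hu : inner ℝ u u = (1 : ℝ))
    (hw : w = u ∨ w = -u) : sphereSupport (sphereOf u w) = planesIn u := by
  have hw1 : inner ℝ w w = (1 : ℝ) := by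
    rcases hw with rfl | rfl
    · exact hu
    · rwa [inner_neg_neg]
  have hpw : planesIn u = planesIn w := by
    rcases hw with rfl | rfl
    · rfl
    · exact (planesIn_neg u).symm
  rw [hpw]
  ext W
  rw [mem_planesIn_iff hw1]
  constructor
  · rintro ⟨f, ⟨e, he, hf⟩, y, rfl⟩
    exact ⟨_, hf y⟩
  · rintro ⟨x, hx⟩
    obtain ⟨e, he⟩ := exists_isHyperplaneBasis hu
    obtain ⟨f, hf⟩ := he.exists_mem_sphereOf hw
    obtain ⟨h1, h2, h3⟩ := (orthonormal_pair_iff _ _).1 hx.orthonormal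
    have hxu : inner ℝ x u = (0 : ℝ) := by
      rcases hw with rfl | rfl
      · exact h3
      · rwa [inner_neg_right, neg_eq_zero] at h3
    obtain ⟨y, rfl⟩ := he.exists_combine h1 hxu
    exact ⟨f, ⟨e, he, hf⟩, y, (hf y).unique hx⟩

theorem combine_neg (e : Fin 9 → R10) (y : R9) : combine (fun i => -e i) y = -combine e y := by
  simp [combine]

/-- Negation of all ten vectors has determinant $(-1)^{10}=1$. This parity is why $u$ and $-u$ give
the same oriented sphere, not opposite ones. -/
theorem IsHyperplaneBasis.neg {u : R10} {e : Fin 9 → R10} (h : IsHyperplaneBasis u e) :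
    IsHyperplaneBasis (-u) fun i => -e i := by
  have hs : snoc91 (fun i => -e i) (-u) = fun i => -snoc91 e u i := by
    funext i
    refine Fin.lastCases ?_ (fun i => ?_) i
    · simp only [snoc91_last]
    · simp only [snoc91_castSucc]
  refine ⟨?_, ?_⟩
  · change Orthonormal ℝ (snoc91 _ _)
    have := orthonormal_iff_ite.1 h.1
    rw [hs, orthonormal_iff_ite]
    intro i j
    rw [inner_neg_neg]
    exact this i j
  · change 0 < (rowMatrix (snoc91 _ _)).det
    have : rowMatrix (snoc91 (fun i => -e i) (-u)) = -rowMatrix (snoc91 e u) := by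
      rw [hs]; rfl
    rw [this, Matrix.det_neg, h.det_eq_one]
    norm_num

theorem sphereOf_neg_subset (u w : R10) : sphereOf u w ⊆ sphereOf (-u) (-w) := by
  rintro f ⟨e, he, hf⟩
  refine ⟨_, he.neg, fun y => ?_⟩
  rw [combine_neg, posCompl_neg_neg]
  exact hf y

theorem sphereOf_neg (u w : R10) : sphereOf (-u) (-w) = sphereOf u w := by
  refine (sphereOf_neg_subset _ _).antisymm' ?_
  have := sphereOf_neg_subset (-u) (-w)
  rwa [neg_neg, neg_neg] at this

theorem sphereH_eq_iff {u v : R10} (hu : inner ℝ u u = (1 : ℝ)) (hv : inner ℝ v v = (1 : ℝ)) :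
    sphereH u = sphereH v ↔ u = v ∨ u = -v := by
  constructor
  · intro h
    rw [sphereH_eq, sphereH_eq] at h
    refine eq_or_eq_neg_of_planesIn_eq hu hv ?_
    rw [← sphereSupport_sphereOf hu (.inl rfl), h, sphereSupport_sphereOf hv (.inl rfl)]
  · rintro (rfl | rfl)
    · rfl
    · exact sphereOf_neg v v

theorem sphereH'_eq_iff {u v : R10} (hu : inner ℝ u u = (1 : ℝ)) (hv : inner ℝ v v = (1 : ℝ)) :
    sphereH' u = sphereH' v ↔ u = v ∨ u = -v := by
  constructor
  · intro h
    rw [sphereH'_eq, sphereH'_eq] at h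
    refine eq_or_eq_neg_of_planesIn_eq hu hv ?_
    rw [← sphereSupport_sphereOf hu (.inr rfl), h, sphereSupport_sphereOf hv (.inr rfl)]
  · rintro (rfl | rfl)
    · rfl
    · rw [sphereH'_eq, sphereH'_eq]
      exact sphereOf_neg v (-v)

/-- A common parametrization would satisfy $x\wedge u=x'\wedge(-u)$ pointwise. At the coordinate
vectors of $S^8$ this forces $e'=-e$, which is impossible for two positive bases in odd dimension 9.
-/
theorem sphereH_ne_sphereH'_self {u : R10} (hu : inner ℝ u u = (1 : ℝ)) :
    sphereH u ≠ sphereH' u := by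
  intro h
  rw [sphereH_eq, sphereH'_eq] at h
  obtain ⟨e, he⟩ := exists_isHyperplaneBasis hu
  obtain ⟨f, hf⟩ := he.exists_mem_sphereOf (.inl rfl)
  have hmem : f ∈ sphereOf u (-u) := h ▸ ⟨e, he, hf⟩
  obtain ⟨e', he', hf'⟩ := hmem
  have key : ∀ i, e' i = -e i := by
    intro i
    have hy : EuclideanSpace.single i (1 : ℝ) ∈ Metric.sphere (0 : R9) 1 := by simp
    have h1 := hf ⟨_, hy⟩
    have h2 := hf' ⟨_, hy⟩
    have hc : ∀ c : Fin 9 → R10, combine c (EuclideanSpace.single i 1) = c i := fun c => by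
      simp [combine]
    simp only [hc] at h1 h2
    have e1 := matAct_wedge_right h1.orthonormal
    have e2 := matAct_wedge_right h2.orthonormal
    rw [← h2.form_eq, h1.form_eq, matAct_neg, e1] at e2
    exact e2.symm
  have hd := det_snoc91_mul hu he'.inner_right he.inner_right
  have hg : gramOf e' e = -1 := by
    rw [← (orthonormal_iff_gramOf e).1 he.orthonormal]
    ext i j
    simp [gramOf, key]
  rw [he'.det_eq_one, he.det_eq_one, hg, Matrix.det_neg] at hd
  norm_num at hd

/-- Equal spheres have equal supports, so the parameters agree up to sign; sign invariance then
reduces to a single $u$. -/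
theorem disjoint_familyH_familyH' : Disjoint familyH familyH' := by
  rw [Set.disjoint_left]
  rintro _ ⟨u, rfl⟩ ⟨v, e⟩
  have hu := inner_self_sphere u
  have hv := inner_self_sphere v
  simp only [sphereH_eq, sphereH'_eq] at e
  have h : v.1 = u.1 ∨ v.1 = -u.1 := by
    refine eq_or_eq_neg_of_planesIn_eq hv hu ?_
    rw [← sphereSupport_sphereOf hv (.inr rfl), e, sphereSupport_sphereOf hu (.inl rfl)]
  rw [← sphereH_eq, ← sphereH'_eq, (sphereH'_eq_iff hv hu).2 h] at e
  exact sphereH_ne_sphereH'_self hu e.symm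

/-! ### Continuity of the families of spheres -/

/-- The last row of a rotation matrix. -/
noncomputable def lastRow (g : SO10) : S9 :=
  ⟨WithLp.toLp 2 (g.1 (Fin.last 9)), mem_sphere_of_inner_self (by
    rw [inner_eq_sum]
    simpa [sq] using sum_sq_row_of_orthogonal (SO10_mul_transpose g) (Fin.last 9))⟩

/-- The first nine rows of a rotation matrix. -/
noncomputable def firstRows (g : SO10) (i : Fin 9) : R10 := WithLp.toLp 2 (g.1 (Fin.castSucc i))

theorem snoc91_rows (g : SO10) : rowMatrix (snoc91 (firstRows g) (lastRow g).1) = g.1 := by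
  ext i k
  change snoc91 (firstRows g) (lastRow g).1 i k = _
  refine Fin.lastCases ?_ (fun i => ?_) i
  · rw [snoc91_last]; rfl
  · rw [snoc91_castSucc]; rfl

theorem isHyperplaneBasis_firstRows (g : SO10) :
    IsHyperplaneBasis (lastRow g).1 (firstRows g) := by
  refine ⟨(orthonormal_iff_gramOf (snoc91 _ _)).2 ?_, ?_⟩
  · rw [← rowMatrix_mul_transpose, snoc91_rows, SO10_mul_transpose]
  · change 0 < (rowMatrix (snoc91 _ _)).det
    rw [snoc91_rows, show g.1.det = 1 from g.2.2]
    norm_num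

theorem continuous_row (i : Fin 10) :
    Continuous fun g : SO10 => (WithLp.toLp 2 (g.1 i) : R10) :=
  (PiLp.continuous_toLp 2 _).comp ((continuous_apply i).comp continuous_subtype_val)

theorem continuous_lastRow : Continuous lastRow := (continuous_row (Fin.last 9)).subtype_mk _

theorem lastRow_surjective : Function.Surjective lastRow := by
  intro u
  obtain ⟨e, he⟩ := exists_isHyperplaneBasis (inner_self_sphere u)
  have h1 := (orthonormal_iff_gramOf (snoc91 e u.1)).1 he.1
  rw [← rowMatrix_mul_transpose] at h1
  refine ⟨⟨rowMatrix (snoc91 e u.1), mem_SO10_iff.2 ⟨h1, he.det_eq_one⟩⟩, Subtype.ext ?_⟩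
  ext k
  change snoc91 e u.1 (Fin.last 9) k = _
  rw [snoc91_last]

/-- $S^9$ is not parallelizable, so $u^\perp$ has no continuous choice of basis over it. Over
$\mathrm{SO}(10)$ the other nine rows provide one, and continuity descends along this quotient map.
-/
theorem isQuotientMap_lastRow : Topology.IsQuotientMap lastRow :=
  continuous_lastRow.isClosedMap.isQuotientMap continuous_lastRow lastRow_surjective

theorem continuous_combine_firstRows :
    Continuous fun w : SO10 × S8 => combine (firstRows w.1) w.2.1 := by
  refine continuous_finsetSum _ fun i _ => Continuous.smul
    (f := fun w : SO10 × S8 => w.2.1 i) (g := fun w : SO10 × S8 => firstRows w.1 i) ?_ ?_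
  · exact (PiLp.continuous_apply 2 _ i).comp (continuous_subtype_val.comp continuous_snd)
  · exact (continuous_row _).comp continuous_fst

/-- The complement of `x ∧ u`, where `u` is the last row and `x` a combination of the others. -/
noncomputable def rowPlane (w : SO10 × S8) : Gr 8 :=
  Gr.compl ⟨_, (isHyperplaneBasis_firstRows w.1).orthonormal_combine (.inl rfl) w.2⟩

theorem posCompl_rowPlane (w : SO10 × S8) :
    PosCompl (rowPlane w) (combine (firstRows w.1) w.2.1) (lastRow w.1).1 :=
  Gr.posCompl_compl ⟨_, (isHyperplaneBasis_firstRows w.1).orthonormal_combine (.inl rfl) w.2⟩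

theorem continuous_rowPlane : Continuous rowPlane :=
  Gr.continuous_compl_pair _ continuous_combine_firstRows
    (continuous_subtype_val.comp (continuous_lastRow.comp continuous_fst))

theorem markedH_lastRow (g : SO10) : markedH (lastRow g).1 =
    Set.range fun y : S8 => (combine (firstRows g) y.1, rowPlane (g, y)) := by
  ext ⟨x, W⟩
  constructor
  · intro (h : PosCompl W x (lastRow g).1)
    obtain ⟨h1, -, h3⟩ := (orthonormal_pair_iff _ _).1 h.orthonormal
    obtain ⟨y, rfl⟩ := (isHyperplaneBasis_firstRows g).exists_combine h1 h3
    exact ⟨y, Prod.ext rfl ((posCompl_rowPlane (g, y)).unique h)⟩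
  · rintro ⟨y, e⟩
    rw [← e]
    exact posCompl_rowPlane (g, y)

theorem planesIn_eq_image {u : R10} (hu : inner ℝ u u = (1 : ℝ)) :
    planesIn u = Prod.snd '' markedH u := by
  ext W
  rw [mem_planesIn_iff hu]
  constructor
  · rintro ⟨x, hx⟩
    exact ⟨(x, W), hx, rfl⟩
  · rintro ⟨⟨x, W'⟩, hx, rfl⟩
    exact ⟨x, hx⟩

theorem vietorisContinuous_markedH : VietorisContinuous fun u : S9 => markedH u.1 := by
  refine VietorisContinuous.of_comp isQuotientMap_lastRow ?_
  simp only [markedH_lastRow]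
  exact vietorisContinuous_image (F := fun w : SO10 × S8 => (combine (firstRows w.1) w.2.1,
    rowPlane w)) (continuous_combine_firstRows.prodMk continuous_rowPlane)

theorem vietorisContinuous_planesIn : VietorisContinuous fun u : S9 => planesIn u.1 := by
  refine VietorisContinuous.of_comp isQuotientMap_lastRow ?_
  simp only [planesIn_eq_image (inner_self_sphere _), markedH_lastRow, ← Set.range_comp]
  exact vietorisContinuous_image (F := rowPlane) continuous_rowPlane

theorem isCompact_markedH (u : S9) : IsCompact (markedH u.1) := by
  obtain ⟨g, rfl⟩ := lastRow_surjective u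
  rw [markedH_lastRow]
  exact isCompact_range ((continuous_combine_firstRows.prodMk continuous_rowPlane).comp
    (Continuous.prodMk_right g))

theorem markedH_injective : Function.Injective fun u : S9 => markedH u.1 := by
  intro u v (h : markedH u.1 = markedH v.1)
  obtain ⟨g, rfl⟩ := lastRow_surjective u
  -- Any point would do: a single marked pair $(x,W)$ determines $u$, since the bivector of $W$
  -- sends $x$ to $-u$.
  let y : S8 := ⟨EuclideanSpace.single 0 1, by simp⟩
  have h1 := posCompl_rowPlane (g, y)
  have h2 : (combine (firstRows g) y.1, rowPlane (g, y)) ∈ markedH v.1 := h ▸ h1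
  have e1 := matAct_wedge_left h1.orthonormal
  have e2 := matAct_wedge_left (PosCompl.orthonormal h2)
  rw [← PosCompl.form_eq h2] at e2
  rw [← h1.form_eq, e2, neg_inj] at e1
  exact Subtype.ext e1.symm

theorem vietorisEmbedding_markedH : VietorisEmbedding fun u : S9 => markedH u.1 :=
  vietorisContinuous_markedH.embedding markedH_injective isCompact_markedH

theorem vietorisEmbedding_markedH' : VietorisEmbedding fun u : S9 => markedH' u.1 := by
  have hneg : Topology.IsEmbedding fun u : S9 => -u :=
    (continuous_neg.isClosedEmbedding neg_injective).isEmbedding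
  let := TopologicalSpace.vietoris (R10 × Gr 8)
  have := Topology.IsEmbedding.comp vietorisEmbedding_markedH hneg
  simp only [VietorisEmbedding, markedH'_eq]
  exact this

theorem vietorisContinuous_planesThrough : VietorisContinuous fun u : S9 => planesThrough u.1 := by
  simp only [planesThrough_eq (inner_self_sphere _)]
  exact vietorisContinuous_planesIn

/-! ### Spheres through a given point -/

/-- The spheres through $W$ belong to the unit vectors $u$ of the circle in $W^\perp$. An open half
circle contains no antipodal pair, so distinct angles give distinct spheres. -/
theorem infinite_of_hyperplanes {W : Gr 8} {S : R10 → Set (S8 → Gr 8)}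
    (hS : ∀ u v : S9, S u = S v ↔ u.1 = v.1 ∨ u.1 = -v.1)
    (hsupp : ∀ u : S9, sphereSupport (S u) = planesIn u) :
    {T ∈ Set.range fun u : S9 => S u | W ∈ sphereSupport T}.Infinite := by
  obtain ⟨p, q, h⟩ := exists_posCompl W
  obtain ⟨h1, h2, h3⟩ := (orthonormal_pair_iff _ _).1 h.orthonormal
  have h3' : inner ℝ q p = (0 : ℝ) := (real_inner_comm _ _).trans h3
  let c : ℝ → R10 := fun t => Real.cos t • p + Real.sin t • q
  have hc : ∀ t, PosCompl W (Real.sin t • p - Real.cos t • q) (c t) := fun t =>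
    h.combination (Real.cos_sq_add_sin_sq t)
  have hc1 : ∀ t, inner ℝ (c t) (c t) = (1 : ℝ) := fun t =>
    ((orthonormal_pair_iff _ _).1 (hc t).orthonormal).2.1
  have hp : ∀ t, inner ℝ p (c t) = Real.cos t := fun t => by
    simp only [c, inner_add_right, real_inner_smul_right, h1, h3]; ring
  have hq : ∀ t, inner ℝ q (c t) = Real.sin t := fun t => by
    simp only [c, inner_add_right, real_inner_smul_right, h2, h3']; ring
  let c' : ℝ → S9 := fun t => ⟨c t, mem_sphere_of_inner_self (hc1 t)⟩
  refine Set.infinite_of_injOn_mapsTo (f := fun t => S (c t)) (s := Set.Ioo 0 Real.pi)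
    ?_ ?_ (Set.Ioo_infinite Real.pi_pos)
  · intro s hs t ht e
    rcases (hS (c' s) (c' t)).1 e with e | e
    · refine Real.injOn_cos (Set.Ioo_subset_Icc_self hs) (Set.Ioo_subset_Icc_self ht) ?_
      rw [← hp s, ← hp t]
      exact congrArg (inner ℝ p) e
    -- The antipodal case would give $\sin s=-\sin t$, but both sines are positive on $(0,\pi)$.
    · have := congrArg (inner ℝ q) e
      rw [inner_neg_right] at this
      have h4 := hq s
      have h5 := hq t
      have h6 := Real.sin_pos_of_mem_Ioo hs
      have h7 := Real.sin_pos_of_mem_Ioo ht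
      simp only [c'] at this
      linarith
  · intro t _
    refine ⟨⟨c' t, rfl⟩, ?_⟩
    have := hsupp (c' t)
    change W ∈ sphereSupport (S (c' t))
    rw [this]
    exact (mem_planesIn_iff (hc1 t)).2 ⟨_, hc t⟩

/-! ### Assembly of the main theorem -/

theorem mainTheorem7 :
    -- the Grassmannian is diffeomorphic to the quadric
    (∃ Φ : Gr 8 ≃ Q8,
      (∀ (W : Gr 8) (p q : R10), PosCompl W p q →
        ((Φ W : ℙ ℂ C10)).submodule = Submodule.span ℂ {complexVec p q}) ∧
      IsSmoothEmbeddingVia Gr.plucker (fun z : Q8 => projOnto z) Φ ∧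
      -- the members of the first two families are complex projective 4-spaces
      (∀ C ∈ familyF ∪ familyF', ∃ E : Submodule ℂ C10, Module.finrank ℂ E = 5 ∧
        (fun W => (Φ W : ℙ ℂ C10)) '' C = projSubspace E)) ∧
    -- SO(10)/U(5) is the space of positive complex structures, and it parametrizes both families
    (∃ j : SO10 ⧸ U5 → Mat10, (∀ g : SO10, j (QuotientGroup.mk g) = conjJ0 g) ∧
      Topology.IsEmbedding j ∧ Set.range j = JPos ∧ Set.range (fun a => -j a) = JNeg ∧
      VietorisEmbedding (fun a => complexLines (j a)) ∧
      Set.range (fun a => complexLines (j a)) = familyF ∧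
      VietorisEmbedding (fun a => complexLines (-j a)) ∧
      Set.range (fun a => complexLines (-j a)) = familyF') ∧
    Disjoint familyF familyF' ∧
    -- the members of the other two families are oriented 8-spheres, parametrized by the 9-sphere
    (∀ u : S9, IsOrientedSphere (sphereH u) ∧ sphereSupport (sphereH u) = planesIn u) ∧
    (∀ u : S9, IsOrientedSphere (sphereH' u) ∧ sphereSupport (sphereH' u) = planesThrough u) ∧
    VietorisEmbedding (fun u : S9 => markedH u) ∧
    VietorisEmbedding (fun u : S9 => markedH' u) ∧
    VietorisContinuous (fun u : S9 => planesIn u) ∧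
    VietorisContinuous (fun u : S9 => planesThrough u) ∧
    (∀ u v : S9, (sphereH u = sphereH v ↔ u = v ∨ u = -v) ∧
      (planesIn u = planesIn v ↔ u = v ∨ u = -v)) ∧
    (∀ u v : S9, (sphereH' u = sphereH' v ↔ u = v ∨ u = -v) ∧
      (planesThrough u = planesThrough v ↔ u = v ∨ u = -v)) ∧
    Disjoint familyH familyH' ∧
    -- every point lies on infinitely many members of each family
    (∀ W : Gr 8, {C ∈ familyF | W ∈ C}.Infinite ∧ {C ∈ familyF' | W ∈ C}.Infinite ∧
      {S ∈ familyH | W ∈ sphereSupport S}.Infinite ∧ {S ∈ familyH' | W ∈ sphereSupport S}.Infinite) := by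
  refine ⟨⟨Equiv.ofBijective Gr.toQuadric Gr.toQuadric_bijective,
    fun W p q h => h.submodule_toQuadric, Gr.isSmoothEmbeddingVia_toQuadric, ?_⟩,
    ⟨quotientConj, quotientConj_mk, isEmbedding_quotientConj, range_quotientConj,
      range_neg_quotientConj, ?_, ?_, ?_, ?_⟩,
    disjoint_familyF_familyF', fun u => ⟨?_, ?_⟩, fun u => ⟨?_, ?_⟩,
    vietorisEmbedding_markedH, vietorisEmbedding_markedH', vietorisContinuous_planesIn,
    vietorisContinuous_planesThrough, fun u v => ⟨?_, ?_⟩, fun u v => ⟨?_, ?_⟩,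
    disjoint_familyH_familyH', fun W => ⟨infinite_familyF W, infinite_familyF' W, ?_, ?_⟩⟩
  · rintro C (⟨J, hJ, rfl⟩ | ⟨J, hJ, rfl⟩)
    · exact ⟨_, finrank_complexSubspace J _, toQuadric_image_complexLines (JPos_subset hJ)⟩
    · exact ⟨_, finrank_complexSubspace J _, toQuadric_image_complexLines (JNeg_subset hJ)⟩
  · exact vietorisEmbedding_complexLines continuous_quotientConj quotientConj_injective
      fun a => JPos_subset (range_quotientConj ▸ ⟨a, rfl⟩)
  · rw [familyF, ← range_quotientConj, ← Set.range_comp]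
    rfl
  · exact vietorisEmbedding_complexLines continuous_quotientConj.neg
      (neg_injective.comp quotientConj_injective)
      fun a => JNeg_subset (range_neg_quotientConj ▸ ⟨a, rfl⟩)
  · rw [familyF', ← range_neg_quotientConj, ← Set.range_comp]
    rfl
  · exact sphereH_eq u.1 ▸ isOrientedSphere_sphereOf (inner_self_sphere u) (.inl rfl)
  · exact sphereH_eq u.1 ▸ sphereSupport_sphereOf (inner_self_sphere u) (.inl rfl)
  · exact sphereH'_eq u.1 ▸ isOrientedSphere_sphereOf (inner_self_sphere u) (.inr rfl)
  · rw [sphereH'_eq, planesThrough_eq (inner_self_sphere u)]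
    exact sphereSupport_sphereOf (inner_self_sphere u) (.inr rfl)
  · rw [sphereH_eq_iff (inner_self_sphere u) (inner_self_sphere v)]
    simp only [Subtype.ext_iff]
    rfl
  · rw [planesIn_eq_iff (inner_self_sphere u) (inner_self_sphere v)]
    simp only [Subtype.ext_iff]
    rfl
  · rw [sphereH'_eq_iff (inner_self_sphere u) (inner_self_sphere v)]
    simp only [Subtype.ext_iff]
    rfl
  · rw [planesThrough_eq (inner_self_sphere u), planesThrough_eq (inner_self_sphere v),
      planesIn_eq_iff (inner_self_sphere u) (inner_self_sphere v)]
    simp only [Subtype.ext_iff]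
    rfl
  · exact infinite_of_hyperplanes (S := sphereH)
      (fun u v => sphereH_eq_iff (inner_self_sphere u) (inner_self_sphere v))
      fun u => sphereSupport_sphereOf (inner_self_sphere u) (.inl rfl)
  · exact infinite_of_hyperplanes (S := sphereH')
      (fun u v => sphereH'_eq_iff (inner_self_sphere u) (inner_self_sphere v))
      fun u => sphereH'_eq u.1 ▸ sphereSupport_sphereOf (inner_self_sphere u) (.inr rfl)
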